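/- Setting. Let $L,d,n\ge 1$ be integers, $X\in\mathbb R^{n\times d}$, $y\in\mathbb R^n$ and $p\in\mathbb R^d$. For $\mathcal W=(W_1,\dots,W_L)$ with $W_k\in\mathbb R^{d\times d}$, let $w_{\rm prod}=W_1^\top\cdots W_L^\top p$ and $$R^L(\mathcal W)=\tfrac1n\|y-Xw_{\rm prod}\|_2^2=R^1(w_{\rm prod}),\qquad R^1(w)=\tfrac1n\|y-Xw\|_2^2 .$$ Let $w^\star$ be the minimizer of $R^1$ of smallest Euclidean norm, assume $w^\star\neq 0$, and let $R_{\min}=R^1(w^\star)$. Let $\hat\Sigma=\frac1n X^\top X$, and let $\lambda$ and $\Lambda$ be its smallest nonzero and its largest eigenvalue. Identify the space of parameters $\mathcal W$ with $\mathbb R^{Ld^2}$. Let $S(\mathcal W)$, the sharpness, be the largest eigenvalue of the Hessian of $R^L$ at $\mathcal W$, and let $S_{\min}=\inf\{S(\mathcal W):\mathcal W\in\arg\min R^L\}$. Statement. For every $s\ge 0$ there exist $C_1,\dots,C_5,C>0$, depending only on $s$, such that the following holds whenever $L\ge C_1$, $d\ge C_2$ and $\hat\Sigma$ is full rank. Let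 $N_1,\dots,N_L$ be random $d\times d$ matrices whose entries are all i.i.d. $\mathcal N(0,1)$, and consider the gradient flow $$\frac{dW_k}{dt}=-\frac{\partial R^L}{\partial W_k}(\mathcal W(t)),\quad t\ge 0,\qquad W_k(0)=I+\frac{s}{\sqrt{Ld}}N_k,\qquad 1\le k\le L .$$ Then, with probability at least $1-16\exp(-C_3d)$, if $$R^L(\mathcal W(0))-R_{\min}\le \frac{C_4\lambda^2\|p\|_2^2}{\Lambda},$$ the gradient flow exists for all times $t\ge 0$ and converges as $t\to\infty$ to a global minimizer $\mathcal W^{\rm RI}$ of $R^L$, which is of the form $W_k^{\rm RI}=I+\frac{s}{\sqrt{Ld}}N_k+\frac1L\theta_k^{\rm RI}$ with $\|\theta_k^{\rm RI}\|_F\le C_5$ for $1\le k\le L$, and which satisfies $$1\le\frac{S(\mathcal W^{\rm RI})}{S_{\min}}\le C\,\frac{\Lambda}{\lambda}.$$ -/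

import Mathlib

open scoped Matrix

noncomputable section

namespace DeepLinear

/-- The weights `𝒲 = (W_1, …, W_L)` of a network of depth `L` with square `d × d` layers, stacked
in one vector of `ℝ^D`, `D = L * d * d`, with the Euclidean norm
(so `‖𝒲‖² = ∑ₖ ‖Wₖ‖_F²`). The layer number comes first, then the row, then the column. -/
abbrev Param (L d : ℕ) : Type := EuclideanSpace ℝ (Fin L × Fin d × Fin d)

/-- The weight matrix `W_{k+1}` (the layers are numbered from `0` here). -/
def layer {L d : ℕ} (W : Param L d) (k : Fin L) : Matrix (Fin d) (Fin d) ℝ :=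
  Matrix.of fun i j => W (k, i, j)

/-- Stacks weight matrices in one parameter vector. -/
def ofLayers {L d : ℕ} (A : Fin L → Matrix (Fin d) (Fin d) ℝ) : Param L d :=
  WithLp.toLp 2 fun a => A a.1 a.2.1 a.2.2

/-- `w_prod = W_1ᵀ ⋯ W_Lᵀ p`: the network is the linear form `x ↦ pᵀ W_L ⋯ W_1 x = w_prodᵀ x`. -/
def wProd {L d : ℕ} (p : EuclideanSpace ℝ (Fin d)) (W : Param L d) : EuclideanSpace ℝ (Fin d) :=
  WithLp.toLp 2 ((List.ofFn fun k => (layer W k)ᵀ).prod *ᵥ p.ofLp)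

/-- The empirical risk of a linear regressor, `R¹(w) = (1/n) ‖y - X w‖²`. -/
def regRisk {n d : ℕ} (X : Matrix (Fin n) (Fin d) ℝ) (y : EuclideanSpace ℝ (Fin n))
    (w : EuclideanSpace ℝ (Fin d)) : ℝ :=
  1 / (n : ℝ) * ‖y - WithLp.toLp 2 (X *ᵥ w.ofLp)‖ ^ 2

/-- The empirical risk of the network, `R^L(𝒲) = R¹(w_prod)`. -/
def netRisk {n d : ℕ} (L : ℕ) (X : Matrix (Fin n) (Fin d) ℝ) (y : EuclideanSpace ℝ (Fin n))
    (p : EuclideanSpace ℝ (Fin d)) (W : Param L d) : ℝ :=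
  regRisk X y (wProd p W)

/-- `w` is the optimal linear regressor `w⋆`: the solution of smallest norm of `min R¹`. -/
def IsOptimalRegressor {n d : ℕ} (X : Matrix (Fin n) (Fin d) ℝ) (y : EuclideanSpace ℝ (Fin n))
    (w : EuclideanSpace ℝ (Fin d)) : Prop :=
  IsMinOn (regRisk X y) Set.univ w ∧
    ∀ v : EuclideanSpace ℝ (Fin d), IsMinOn (regRisk X y) Set.univ v → ‖w‖ ≤ ‖v‖

/-- The empirical covariance matrix `(1/n) Xᵀ X`. -/
def empCov {n d : ℕ} (X : Matrix (Fin n) (Fin d) ℝ) : Matrix (Fin d) (Fin d) ℝ :=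
  (1 / (n : ℝ)) • (Xᵀ * X)

/-- `Λ`, the largest eigenvalue of the empirical covariance matrix. -/
def covMaxEig {n d : ℕ} (X : Matrix (Fin n) (Fin d) ℝ) : ℝ :=
  sSup {μ : ℝ | Module.End.HasEigenvalue (Matrix.toLin' (empCov X)) μ}

/-- `λ`, the smallest nonzero eigenvalue of the empirical covariance matrix. -/
def covMinEig {n d : ℕ} (X : Matrix (Fin n) (Fin d) ℝ) : ℝ :=
  sInf {μ : ℝ | Module.End.HasEigenvalue (Matrix.toLin' (empCov X)) μ ∧ μ ≠ 0}

/-- The Hessian of the risk on `ℝ^D`, as a linear operator: the derivative of the gradient. -/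
def netHessian {n d : ℕ} (L : ℕ) (X : Matrix (Fin n) (Fin d) ℝ) (y : EuclideanSpace ℝ (Fin n))
    (p : EuclideanSpace ℝ (Fin d)) (W : Param L d) : Param L d →L[ℝ] Param L d :=
  fderiv ℝ (fun V : Param L d => gradient (netRisk L X y p) V) W

/-- The sharpness `S(𝒲)`, the largest eigenvalue of the Hessian of the risk at `𝒲`. -/
def sharpness {n d : ℕ} (L : ℕ) (X : Matrix (Fin n) (Fin d) ℝ) (y : EuclideanSpace ℝ (Fin n))
    (p : EuclideanSpace ℝ (Fin d)) (W : Param L d) : ℝ :=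
  sSup {μ : ℝ | Module.End.HasEigenvalue (netHessian L X y p W : Param L d →ₗ[ℝ] Param L d) μ}

/-- `S_min`, the infimum of the sharpness over all global minimizers of the risk `R^L`. -/
def minSharpness {n d : ℕ} (L : ℕ) (X : Matrix (Fin n) (Fin d) ℝ) (y : EuclideanSpace ℝ (Fin n))
    (p : EuclideanSpace ℝ (Fin d)) : ℝ :=
  sInf (sharpness L X y p '' {W : Param L d | IsMinOn (netRisk L X y p) Set.univ W})

/-- `W : [0, ∞) → ℝ^D` is a gradient flow of the risk started at `W₀`: it solves
`dW/dt = -∇R^L(W)` for all times `t ≥ 0` (with a one-sided derivative at `0`). Its values at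
negative times are irrelevant. -/
def IsGradientFlow {n d : ℕ} (L : ℕ) (X : Matrix (Fin n) (Fin d) ℝ)
    (y : EuclideanSpace ℝ (Fin n)) (p : EuclideanSpace ℝ (Fin d)) (W₀ : Param L d)
    (W : ℝ → Param L d) : Prop :=
  W 0 = W₀ ∧ ∀ t : ℝ, 0 ≤ t →
    HasDerivWithinAt W (-gradient (netRisk L X y p) (W t)) (Set.Ici 0) t

/-- The Frobenius norm of a square matrix. -/
def frobNorm {d : ℕ} (A : Matrix (Fin d) (Fin d) ℝ) : ℝ :=
  Real.sqrt (∑ i, ∑ j, A i j ^ 2)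

/-- The parameters `W_k = I + s / √(L d) N_k + (1 / L) θ_k` of a residual network. -/
def residualParam {L d : ℕ} (s : ℝ) (N θ : Fin L → Matrix (Fin d) (Fin d) ℝ) : Param L d :=
  ofLayers fun k => 1 + (s / Real.sqrt ((L : ℝ) * (d : ℝ))) • N k + (1 / (L : ℝ)) • θ k

/-- The residual initialization `W_k(0) = I + s / √(L d) N_k`, that is `θ = 0`. -/
def residualInit {L d : ℕ} (s : ℝ) (N : Fin L → Matrix (Fin d) (Fin d) ℝ) : Param L d :=
  residualParam s N 0

/-- The random matrices `N_1, …, N_L` have i.i.d. standard Gaussian entries. -/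
def IsStdGaussianFamily {Ω : Type*} [MeasurableSpace Ω] (P : MeasureTheory.Measure Ω) {L d : ℕ}
    (N : Ω → Fin L → Matrix (Fin d) (Fin d) ℝ) : Prop :=
  (∀ k i j, Measurable fun ω => N ω k i j) ∧
  (∀ k i j, P.map (fun ω => N ω k i j) = ProbabilityTheory.gaussianReal 0 1) ∧
  ProbabilityTheory.iIndepFun
    (fun (a : Fin L × Fin d × Fin d) (ω : Ω) => N ω a.1 a.2.1 a.2.2) P

end DeepLinear

end

/-! The mechanism is good conditioning of all partial products of layers, with constants independent
of `L` and `d`. It holds at initialization, survives perturbations of size `O(1/L)` per layer, and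
yields convergence as well as the sharpness bound.

Initialization. The layers are cut into a number `B` of blocks depending only on `s`. Inside a
block, `⟨y, (M - 1) x⟩` is a martingale as factors are added to the product `M`, with Gaussian
increments whose conditional variance is bounded as long as `M` stays near `1`. Setting the
coefficients to zero after the exit from the ball of radius `1/2` and taking the mean-one
exponential of the stopped martingale (`lintegral_exp_predictable`), Markov's inequality and a union
bound over a net show that the block product leaves this ball with exponentially small probability
(`measure_not_tame_le`). Hence all initial products and their inverses have norm at most `K = 2 ^
B`.

Convergence. If every layer moves by at most `r / L`, products of consecutive layers keep condition
constants `2 * K ^ 2` (`bddUnit_runProd_add`). There the excess risk satisfies a Polyak-Łojasiewicz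
inequality with a constant of order `L`, while the gradient of each single layer is at most a
constant times the square root of the excess risk (`gradientTrap_netRisk`). The risk then decays
exponentially, and the integrated speed of each layer stays below `r / L` when the initial risk is
small, so the flow cannot leave the region and converges to a zero of the excess risk
(`GradientTrap`).

Sharpness. At a minimizer the Hessian is `2 J* A J`, with `J` the Jacobian of `w_prod` and `A` the
covariance. Conditioning bounds `J` from above at the limit. At an arbitrary minimizer, AM-GM
applied to telescoping ratios of norms of partial products bounds `J*` from below
(`le_sq_norm_wJacAdj`). Both bounds are proportional to `L`, which cancels in the ratio. -/

noncomputable section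

open scoped Matrix.Norms.L2Operator

namespace DeepLinear

/-! ### Conditioning of ordered products in a normed ring -/

section RunProd

variable {R : Type*}

/-- The product `a 0 * a 1 * ⋯ * a (k - 1)`. -/
def runProd [Monoid R] (a : ℕ → R) (k : ℕ) : R := ((List.range k).map a).prod

@[simp] lemma runProd_zero [Monoid R] (a : ℕ → R) : runProd a 0 = 1 := by simp [runProd]

lemma runProd_succ [Monoid R] (a : ℕ → R) (k : ℕ) : runProd a (k + 1) = runProd a k * a k := by
  simp [runProd, List.range_succ]

lemma runProd_add [Monoid R] (a : ℕ → R) (i k : ℕ) :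
    runProd a (i + k) = runProd a i * runProd (fun j => a (i + j)) k := by
  induction k with
  | zero => simp
  | succ k ih => rw [← add_assoc, runProd_succ, ih, runProd_succ, mul_assoc]

lemma runProd_congr [Monoid R] {a b : ℕ → R} {k : ℕ} (h : ∀ j < k, a j = b j) :
    runProd a k = runProd b k := by
  unfold runProd
  congr 1
  exact List.map_congr_left fun j hj => h j (List.mem_range.1 hj)

variable [NormedRing R]

/-- `P` is invertible, and both `P` and its inverse have norm at most `K`. -/
def BddUnit (K : ℝ) (P : R) : Prop :=
  ∃ Q : R, P * Q = 1 ∧ Q * P = 1 ∧ ‖P‖ ≤ K ∧ ‖Q‖ ≤ K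

lemma BddUnit.mono {K K' : ℝ} {P : R} (h : BddUnit K P) (hK : K ≤ K') : BddUnit K' P := by
  obtain ⟨Q, h1, h2, h3, h4⟩ := h
  exact ⟨Q, h1, h2, h3.trans hK, h4.trans hK⟩

lemma BddUnit.nonneg {K : ℝ} {P : R} (h : BddUnit K P) : 0 ≤ K := by
  obtain ⟨Q, -, -, h3, -⟩ := h
  exact (norm_nonneg P).trans h3

lemma BddUnit.mul {K K' : ℝ} {P P' : R} (h : BddUnit K P) (h' : BddUnit K' P') :
    BddUnit (K * K') (P * P') := by
  have hK := h.nonneg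
  have hK' := h'.nonneg
  obtain ⟨Q, h1, h2, h3, h4⟩ := h
  obtain ⟨Q', h1', h2', h3', h4'⟩ := h'
  refine ⟨Q' * Q, ?_, ?_, ?_, ?_⟩
  · rw [mul_assoc, ← mul_assoc P', h1', one_mul, h1]
  · rw [mul_assoc, ← mul_assoc Q, h2, one_mul, h2']
  · exact (norm_mul_le _ _).trans (mul_le_mul h3 h3' (norm_nonneg _) hK)
  · rw [mul_comm K]
    exact (norm_mul_le _ _).trans (mul_le_mul h4' h4 (norm_nonneg _) hK')

lemma BddUnit.exists_inv {K : ℝ} {P : R} (h : BddUnit K P) :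
    ∃ Q : R, P * Q = 1 ∧ Q * P = 1 ∧ BddUnit K Q := by
  obtain ⟨Q, h1, h2, h3, h4⟩ := h
  exact ⟨Q, h1, h2, P, h2, h1, h4, h3⟩

/-- Neumann series: the inverse has norm at most `(1 - 1/2)⁻¹`. The unit is only assumed to have
norm at most `1`, so that `0 × 0` matrices are covered. -/
lemma bddUnit_of_norm_sub_one_le [CompleteSpace R] (h1 : ‖(1 : R)‖ ≤ 1) {T : R}
    (h : ‖T - 1‖ ≤ 1 / 2) : BddUnit 2 T := by
  have ht : ‖1 - T‖ < 1 := by rw [norm_sub_rev]; linarith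
  have hb := tsum_geometric_le_of_norm_lt_one (1 - T) ht
  have hinv : (1 - ‖1 - T‖)⁻¹ ≤ 2 := by
    rw [norm_sub_rev, inv_le_comm₀ (by linarith) (by norm_num)]
    linarith
  refine ⟨∑' n : ℕ, (1 - T) ^ n, ?_, ?_, ?_, ?_⟩
  · simpa using mul_neg_geom_series (1 - T) ht
  · simpa using geom_series_mul_neg (1 - T) ht
  · calc ‖T‖ = ‖(T - 1) + 1‖ := by simp
      _ ≤ ‖T - 1‖ + ‖(1 : R)‖ := norm_add_le _ _
      _ ≤ 2 := by linarith
  · linarith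

/-- Products of `m * B` factors, if the products inside of each block of `m` factors are close
to `1`. -/
lemma bddUnit_runProd_of_blocks [CompleteSpace R] (h1 : ‖(1 : R)‖ ≤ 1) (a : ℕ → R) (m : ℕ)
    (B : ℕ) (h : ∀ b < B, ∀ j ≤ m, ‖runProd (fun i => a (b * m + i)) j - 1‖ ≤ 1 / 2) :
    (∀ k ≤ B * m, BddUnit (2 ^ B) (runProd a k)) := by
  have h12 : BddUnit 1 (1 : R) := ⟨1, by simp, by simp, h1, h1⟩
  induction B with
  | zero =>
    intro k hk
    obtain rfl : k = 0 := by simpa using hk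
    simpa using h12
  | succ B ih =>
    have ih' := ih fun b hb => h b (hb.trans (Nat.lt_succ_self _))
    intro k hk
    by_cases hkB : k ≤ B * m
    · exact (ih' k hkB).mono (pow_le_pow_right₀ (by norm_num) (Nat.le_succ _))
    · obtain ⟨j, rfl⟩ := Nat.exists_eq_add_of_le (not_le.1 hkB).le
      rw [runProd_add, pow_succ]
      refine (ih' _ le_rfl).mul (bddUnit_of_norm_sub_one_le h1 (h B (Nat.lt_succ_self _) j ?_))
      rw [add_mul, one_mul] at hk
      omega

/-- Perturbing each factor of a product, all of whose initial segments are well conditioned. -/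
lemma exists_runProd_add_eq (a e : ℕ → R) (h1 : ‖(1 : R)‖ ≤ 1) {K ε : ℝ} {n : ℕ}
    (hM : ∀ k ≤ n, BddUnit K (runProd a k)) (he : ∀ k < n, ‖e k‖ ≤ ε) (i k : ℕ)
    (hik : i + k ≤ n) :
    ∃ T Q : R, runProd (fun j => a (i + j) + e (i + j)) k = Q * T * runProd a (i + k) ∧
      BddUnit K Q ∧ ‖T - 1‖ ≤ (1 + K ^ 2 * ε) ^ k - 1 := by
  obtain ⟨Q, hQ1, hQ2, hQ⟩ := (hM i (by omega)).exists_inv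
  induction k with
  | zero => exact ⟨1, Q, by simp [hQ2], hQ, by simp⟩
  | succ k ih =>
    obtain ⟨T, Q, hT, hQ, hT1⟩ := ih (by omega)
    obtain ⟨S, hS1, hS2, S', hS1', hS2', hS3, hS4⟩ := (hM (i + (k + 1)) hik).exists_inv
    have hMk := hM (i + k) (by omega)
    have hK := hMk.nonneg
    obtain ⟨-, -, -, hMk, -⟩ := hMk
    have hε : 0 ≤ ε := (norm_nonneg _).trans (he (i + k) (by omega))
    -- With `S` the inverse of the next unperturbed product, `P_k (a_k + e_k) = (1 + E) P_{k+1}`: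
    -- conjugation turns an additive error in one factor into a factor close to `1`.
    set E := runProd a (i + k) * e (i + k) * S with hE
    have hEn : ‖E‖ ≤ K ^ 2 * ε := by
      calc ‖E‖ ≤ ‖runProd a (i + k)‖ * ‖e (i + k)‖ * ‖S‖ :=
            (norm_mul_le _ _).trans (by gcongr; exact norm_mul_le _ _)
        _ ≤ K * ε * K := by
            gcongr
            exact he _ (by omega)
        _ = K ^ 2 * ε := by ring
    refine ⟨T * (1 + E), Q, ?_, hQ, ?_⟩
    · rw [runProd_succ, hT]
      have : (1 + E) * runProd a (i + (k + 1))
          = runProd a (i + k) * (a (i + k) + e (i + k)) := by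
        rw [hE, add_mul, mul_assoc _ S, hS2, mul_one, one_mul, ← add_assoc, runProd_succ, mul_add]
      simp only [mul_assoc, this]
    · have hT2 : ‖T‖ ≤ (1 + K ^ 2 * ε) ^ k := by
        calc ‖T‖ = ‖(T - 1) + 1‖ := by simp
          _ ≤ ‖T - 1‖ + ‖(1 : R)‖ := norm_add_le _ _
          _ ≤ _ := by linarith
      calc ‖T * (1 + E) - 1‖ = ‖(T - 1) + T * E‖ := by congr 1; noncomm_ring
        _ ≤ ‖T - 1‖ + ‖T‖ * ‖E‖ := (norm_add_le _ _).trans (by gcongr; exact norm_mul_le _ _)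
        _ ≤ ((1 + K ^ 2 * ε) ^ k - 1) + (1 + K ^ 2 * ε) ^ k * (K ^ 2 * ε) := by
            gcongr
        _ = _ := by ring

/-- The `k ≤ n` errors compound to at most `exp (K ^ 2 * r) - 1 ≤ exp (1/3) - 1 ≤ 1/2`. The product
is then an inverse of an initial product, a factor conditioned by `2`, and an initial product,
whence `K * 2 * K`. -/
lemma bddUnit_runProd_add [CompleteSpace R] (a e : ℕ → R) (h1 : ‖(1 : R)‖ ≤ 1) {K r : ℝ} {n : ℕ}
    (hM : ∀ k ≤ n, BddUnit K (runProd a k)) (he : ∀ k < n, ‖e k‖ ≤ r / n)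
    (hr0 : 0 ≤ r) (hr : K ^ 2 * r ≤ 1 / 3) (i k : ℕ) (hik : i + k ≤ n) :
    BddUnit (2 * K ^ 2) (runProd (fun j => a (i + j) + e (i + j)) k) := by
  obtain ⟨T, Q, hT, hQ, hT1⟩ := exists_runProd_add_eq a e h1 hM he i k hik
  have hpow : (1 + K ^ 2 * (r / n)) ^ k ≤ 3 / 2 := by
    rcases Nat.eq_zero_or_pos n with hn | hn
    · obtain rfl : k = 0 := by omega
      norm_num
    have hn' : (0 : ℝ) < n := by exact_mod_cast hn
    have hx : 0 ≤ K ^ 2 * (r / n) := by positivity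
    calc (1 + K ^ 2 * (r / n)) ^ k ≤ (1 + K ^ 2 * (r / n)) ^ n :=
          pow_le_pow_right₀ (by linarith) (by omega)
      _ ≤ (Real.exp (K ^ 2 * (r / n))) ^ n := by
          gcongr
          rw [add_comm]
          exact Real.add_one_le_exp _
      _ = Real.exp (K ^ 2 * r) := by
          rw [← Real.exp_nat_mul]
          congr 1
          field_simp
      _ ≤ Real.exp (1 / 3) := Real.exp_le_exp.2 hr
      _ ≤ 3 / 2 := by
          have := Real.exp_bound' (x := 1 / 3) (by norm_num) (by norm_num) (n := 3) (by norm_num)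
          refine this.trans ?_
          norm_num [Finset.sum_range_succ, Nat.factorial]
  rw [hT]
  have h := (hQ.mul (bddUnit_of_norm_sub_one_le h1 (T := T) (by linarith))).mul (hM _ hik)
  exact h.mono (by nlinarith)

end RunProd

/-! ### Matrices acting on Euclidean space -/

section MatrixBounds

variable {d : ℕ}

lemma norm_one_matrix_le : ‖(1 : Matrix (Fin d) (Fin d) ℝ)‖ ≤ 1 := by
  rw [Matrix.l2_opNorm_def]
  refine ContinuousLinearMap.opNorm_le_bound _ zero_le_one fun x => ?_
  simp

lemma norm_transpose_matrix (A : Matrix (Fin d) (Fin d) ℝ) : ‖Aᵀ‖ = ‖A‖ := by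
  simpa using Matrix.l2_opNorm_conjTranspose A

/-- The action of a matrix on a Euclidean vector. -/
abbrev act (A : Matrix (Fin d) (Fin d) ℝ) (x : EuclideanSpace ℝ (Fin d)) :
    EuclideanSpace ℝ (Fin d) := WithLp.toLp 2 (A *ᵥ x.ofLp)

lemma act_mul (A B : Matrix (Fin d) (Fin d) ℝ) (x : EuclideanSpace ℝ (Fin d)) :
    act (A * B) x = act A (act B x) := by
  simp [act, Matrix.mulVec_mulVec]

lemma norm_act_le (A : Matrix (Fin d) (Fin d) ℝ) (x : EuclideanSpace ℝ (Fin d)) :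
    ‖act A x‖ ≤ ‖A‖ * ‖x‖ := Matrix.l2_opNorm_mulVec A x

lemma inner_act (A : Matrix (Fin d) (Fin d) ℝ) (x y : EuclideanSpace ℝ (Fin d)) :
    inner ℝ x (act A y) = inner ℝ (act Aᵀ x) y := by
  simp only [EuclideanSpace.inner_eq_star_dotProduct, star_trivial, act]
  rw [Matrix.mulVec_transpose, dotProduct_comm (A *ᵥ _), Matrix.dotProduct_mulVec, dotProduct_comm]

lemma BddUnit.transpose {K : ℝ} {A : Matrix (Fin d) (Fin d) ℝ} (h : BddUnit K A) :
    BddUnit K Aᵀ := by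
  obtain ⟨Q, h1, h2, h3, h4⟩ := h
  refine ⟨Qᵀ, ?_, ?_, ?_, ?_⟩
  · rw [← Matrix.transpose_mul, h2, Matrix.transpose_one]
  · rw [← Matrix.transpose_mul, h1, Matrix.transpose_one]
  · rwa [norm_transpose_matrix]
  · rwa [norm_transpose_matrix]

lemma BddUnit.norm_act_le {K : ℝ} {A : Matrix (Fin d) (Fin d) ℝ} (h : BddUnit K A)
    (x : EuclideanSpace ℝ (Fin d)) : ‖act A x‖ ≤ K * ‖x‖ := by
  obtain ⟨Q, h1, h2, h3, h4⟩ := h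
  exact (DeepLinear.norm_act_le A x).trans (by gcongr)

lemma BddUnit.le_norm_act {K : ℝ} {A : Matrix (Fin d) (Fin d) ℝ} (h : BddUnit K A)
    (x : EuclideanSpace ℝ (Fin d)) : ‖x‖ ≤ K * ‖act A x‖ := by
  obtain ⟨Q, h1, h2, h3, h4⟩ := h
  calc ‖x‖ = ‖act Q (act A x)‖ := by rw [← act_mul, h2]; simp [act]
    _ ≤ ‖Q‖ * ‖act A x‖ := DeepLinear.norm_act_le _ _
    _ ≤ _ := by gcongr

lemma norm_le_frobNorm (A : Matrix (Fin d) (Fin d) ℝ) : ‖A‖ ≤ frobNorm A := by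
  rw [Matrix.l2_opNorm_def]
  refine ContinuousLinearMap.opNorm_le_bound _ (Real.sqrt_nonneg _) fun x => ?_
  change ‖act A x‖ ≤ _
  rw [frobNorm, EuclideanSpace.norm_eq x, EuclideanSpace.norm_eq,
    ← Real.sqrt_mul (by positivity)]
  refine Real.sqrt_le_sqrt ?_
  rw [Finset.sum_mul]
  refine Finset.sum_le_sum fun i _ => ?_
  simp only [Real.norm_eq_abs, sq_abs, Matrix.mulVec, dotProduct]
  exact Finset.sum_mul_sq_le_sq_mul_sq _ _ _

end MatrixBounds

/-! ### Exponential martingales of Gaussian variables -/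

section ExponentialMartingale

open MeasureTheory ProbabilityTheory

variable {Ω ι : Type*} [MeasurableSpace Ω] [Fintype ι] {P : Measure Ω}

/-- The Gaussian moment generating function `exp (c ^ 2 / 2)` cancels the normalization. Working
with `lintegral` lets Tonelli be used later without integrability. -/
lemma lintegral_exp_gaussian {X : Ω → ℝ} (hX : Measurable X)
    (hlaw : P.map X = gaussianReal 0 1) (c : ℝ) :
    ∫⁻ ω, ENNReal.ofReal (Real.exp (c * X ω - c ^ 2 / 2)) ∂P = 1 := by
  have hint : Integrable (fun ω => Real.exp (c * X ω)) P := by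
    have := integrable_exp_mul_gaussianReal (μ := 0) (v := 1) c
    rw [← hlaw] at this
    exact this.comp_measurable hX
  have hmgf := mgf_gaussianReal hlaw c
  rw [mgf] at hmgf
  simp_rw [Real.exp_sub]
  rw [← ofReal_integral_eq_lintegral_ofReal (hint.div_const _)
    (Filter.Eventually.of_forall fun _ => by positivity), integral_div, hmgf]
  simp

/-- The exponential martingale of a family of independent Gaussian variables with predictable
coefficients: the coefficient of the variable `a` may depend on the variables of smaller rank. -/
lemma lintegral_exp_predictable {X : ι → Ω → ℝ} (hX : ∀ a, Measurable (X a))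
    (hlaw : ∀ a, P.map (X a) = gaussianReal 0 1) (hind : iIndepFun X P) (ρ : ι → ℕ)
    (w : ι → (ι → ℝ) → ℝ) (hw : ∀ a, Measurable (w a))
    (hpred : ∀ a N N', (∀ b, ρ b < ρ a → N b = N' b) → w a N = w a N') (k : ℕ) :
    ∫⁻ ω, ENNReal.ofReal (Real.exp (∑ a with ρ a < k,
      (w a (fun b => X b ω) * X a ω - w a (fun b => X b ω) ^ 2 / 2))) ∂P = 1 := by
  classical
  have := hind.isProbabilityMeasure
  induction k with
  | zero => simp
  | succ k ih =>
    set S : Finset ι := Finset.univ.filter fun a => ρ a < k with hS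
    set T : Finset ι := Finset.univ.filter fun a => ρ a = k with hT
    have hST : Disjoint S T := by
      rw [Finset.disjoint_filter]
      intro a _ h1 h2
      omega
    have hunion : (Finset.univ.filter fun a => ρ a < k + 1) = S ∪ T := by
      ext a
      simp [S, T]
      omega
    -- The coefficients of rank at most `k` only see the variables in `S`, so they factor through
    -- the restriction to `S`; the value `0` elsewhere is arbitrary.
    let ext : (S → ℝ) → ι → ℝ := fun u a => if h : a ∈ S then u ⟨a, h⟩ else 0
    have hext : Measurable ext := by
      refine measurable_pi_lambda _ fun a => ?_
      by_cases h : a ∈ S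
      · simpa [ext, h] using measurable_pi_apply _
      · simp [ext, h]
    have hwext : ∀ a, ρ a ≤ k → ∀ N : ι → ℝ, w a N = w a (ext fun b => N b) := by
      intro a ha N
      refine hpred a _ _ fun b hb => ?_
      have hb' : b ∈ S := by simp [S]; omega
      simp [ext, hb']
    let U : Ω → S → ℝ := fun ω a => X a ω
    let V : Ω → T → ℝ := fun ω a => X a ω
    have hU : Measurable U := measurable_pi_lambda _ fun a => hX a
    have hV : Measurable V := measurable_pi_lambda _ fun a => hX a
    have hUV : IndepFun U V P := hind.indepFun_finset S T hST hX
    let F : (S → ℝ) → ℝ := fun u =>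
      ∑ a : S, (w a (ext u) * u a - w a (ext u) ^ 2 / 2)
    let H : (S → ℝ) → (T → ℝ) → ℝ := fun u n =>
      ∑ a : T, (w a (ext u) * n a - w a (ext u) ^ 2 / 2)
    have hF : Measurable F := by
      refine Finset.measurable_sum _ fun a _ => ?_
      have := (hw a).comp hext
      fun_prop
    have hH : Measurable (Function.uncurry H) := by
      refine Finset.measurable_sum _ fun a _ => ?_
      have h1 : Measurable fun q : (S → ℝ) × (T → ℝ) => w a (ext q.1) :=
        ((hw a).comp hext).comp measurable_fst
      have h2 : Measurable fun q : (S → ℝ) × (T → ℝ) => q.2 a :=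
        (measurable_pi_apply a).comp measurable_snd
      exact (h1.mul h2).sub ((h1.pow_const 2).div_const 2)
    have hFS : ∀ ω, F (U ω) = ∑ a ∈ S,
        (w a (fun b => X b ω) * X a ω - w a (fun b => X b ω) ^ 2 / 2) := by
      intro ω
      rw [← Finset.sum_coe_sort]
      refine Finset.sum_congr rfl fun a _ => ?_
      have ha : ρ a < k := (Finset.mem_filter.1 a.2).2
      rw [hwext a ha.le fun b => X b ω]
    have hHT : ∀ ω, H (U ω) (V ω) = ∑ a ∈ T,
        (w a (fun b => X b ω) * X a ω - w a (fun b => X b ω) ^ 2 / 2) := by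
      intro ω
      rw [← Finset.sum_coe_sort]
      refine Finset.sum_congr rfl fun a _ => ?_
      have ha : ρ a = k := (Finset.mem_filter.1 a.2).2
      rw [hwext a ha.le fun b => X b ω]
    -- With the variables of lower rank frozen at `u`, the rank-`k` factor is a product of
    -- independent one-dimensional exponentials of mean one.
    have hinner : ∀ u : S → ℝ,
        ∫⁻ n, ENNReal.ofReal (Real.exp (H u n)) ∂(P.map V) = 1 := by
      intro u
      have hHu : Measurable (H u) := hH.comp (measurable_const.prodMk measurable_id)
      rw [lintegral_map (by fun_prop) hV]
      have : ∀ ω, ENNReal.ofReal (Real.exp (H u (V ω))) = ∏ a ∈ T,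
          ENNReal.ofReal (Real.exp (w a (ext u) * X a ω - w a (ext u) ^ 2 / 2)) := by
        intro ω
        rw [← ENNReal.ofReal_prod_of_nonneg fun _ _ => (Real.exp_pos _).le, ← Real.exp_sum,
          ← Finset.sum_coe_sort]
      simp_rw [this]
      rw [lintegral_prod_eq_prod_lintegral_of_indepFun T
        (fun a ω => ENNReal.ofReal (Real.exp (w a (ext u) * X a ω - w a (ext u) ^ 2 / 2)))]
      · exact Finset.prod_eq_one fun a _ => lintegral_exp_gaussian (hX a) (hlaw a) _
      · exact hind.comp
          (fun a t => ENNReal.ofReal (Real.exp (w a (ext u) * t - w a (ext u) ^ 2 / 2)))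
          fun a => by fun_prop
      · intro a
        have := hX a
        fun_prop
    rw [hunion]
    simp_rw [Finset.sum_union hST, ← hFS, ← hHT]
    simp_rw [← hFS] at ih
    have hmeas : Measurable fun q : (S → ℝ) × (T → ℝ) =>
        ENNReal.ofReal (Real.exp (F q.1 + H q.1 q.2)) := by
      have h1 : Measurable fun q : (S → ℝ) × (T → ℝ) => F q.1 := hF.comp measurable_fst
      exact (h1.add hH).exp.ennreal_ofReal
    rw [← lintegral_map (f := fun q : (S → ℝ) × (T → ℝ) =>
        ENNReal.ofReal (Real.exp (F q.1 + H q.1 q.2))) (g := fun ω => (U ω, V ω))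
        hmeas (hU.prodMk hV), hUV.map_prod_eq_prod_map_map hU.aemeasurable hV.aemeasurable,
      lintegral_prod _ hmeas.aemeasurable]
    have : ∀ u, ∫⁻ n, ENNReal.ofReal (Real.exp (F u + H u n)) ∂(P.map V)
        = ENNReal.ofReal (Real.exp (F u)) := by
      intro u
      have hHu : Measurable (H u) := hH.comp (measurable_const.prodMk measurable_id)
      simp_rw [Real.exp_add, ENNReal.ofReal_mul (Real.exp_pos (F u)).le]
      rw [lintegral_const_mul _ (by fun_prop), hinner, mul_one]
    simp_rw [this]
    rw [lintegral_map (by fun_prop) hU, ih]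

end ExponentialMartingale

/-! ### Nets in the unit ball -/

section Nets

/-- The unit ball of `ℝ^d` has a `1/2`-net with at most `5^d` elements. -/
lemma exists_half_net (E : Type*) [NormedAddCommGroup E] [NormedSpace ℝ E]
    [FiniteDimensional ℝ E] : ∃ S : Finset E, S.card ≤ 5 ^ Module.finrank ℝ E ∧
      (∀ x ∈ S, ‖x‖ ≤ 1) ∧ ∀ x : E, ‖x‖ ≤ 1 → ∃ y ∈ S, ‖x - y‖ ≤ 1 / 2 := by
  classical
  let Q : ℕ → Prop := fun n => ∃ S : Finset E, S.card = n ∧ (∀ x ∈ S, ‖x‖ ≤ 1) ∧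
    ∀ x ∈ S, ∀ y ∈ S, x ≠ y → 1 / 2 ≤ ‖x - y‖
  have hbound : ∀ S : Finset E, (∀ x ∈ S, ‖x‖ ≤ 1) →
      (∀ x ∈ S, ∀ y ∈ S, x ≠ y → 1 / 2 ≤ ‖x - y‖) → S.card ≤ 5 ^ Module.finrank ℝ E := by
    intro S h1 h2
    -- Doubling turns the unit ball and separation `1/2` into the ball of radius `2` and separation
    -- `1`, the scale of `Besicovitch.card_le_of_separated`.
    have hinj : Function.Injective fun x : E => (2 : ℝ) • x :=
      smul_right_injective E two_ne_zero
    rw [← Finset.card_image_of_injective S hinj]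
    refine Besicovitch.card_le_of_separated _ ?_ ?_
    · intro c hc
      obtain ⟨x, hx, rfl⟩ := Finset.mem_image.1 hc
      rw [norm_smul, Real.norm_ofNat]
      linarith [h1 x hx]
    · intro c hc e he hce
      obtain ⟨x, hx, rfl⟩ := Finset.mem_image.1 hc
      obtain ⟨y, hy, rfl⟩ := Finset.mem_image.1 he
      have := h2 x hx y hy fun h => hce (by rw [h])
      rw [← smul_sub, norm_smul, Real.norm_ofNat]
      linarith
  have hQ0 : Q 0 := ⟨∅, by simp⟩
  -- A `1/2`-separated set of maximal cardinality is a net: an uncovered point could be added to it.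
  obtain ⟨S, hS, h1, h2⟩ := Nat.findGreatest_spec (P := Q) (Nat.zero_le (5 ^ Module.finrank ℝ E)) hQ0
  refine ⟨S, hbound S h1 h2, h1, fun x hx => ?_⟩
  by_contra! hcon
  have hxS : x ∉ S := fun h => by
    have := hcon x h
    simp at this
    linarith
  have hQ' : Q (S.card + 1) := by
    refine ⟨insert x S, Finset.card_insert_of_notMem hxS, ?_, ?_⟩
    · intro y hy
      rcases Finset.mem_insert.1 hy with rfl | hy
      exacts [hx, h1 y hy]
    · intro y hy z hz hyz
      rcases Finset.mem_insert.1 hy with hyx | hyS <;> rcases Finset.mem_insert.1 hz with hzx | hzS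
      · exact absurd (hyx.trans hzx.symm) hyz
      · exact hyx ▸ (hcon z hzS).le
      · rw [norm_sub_rev]
        exact hzx ▸ (hcon y hyS).le
      · exact h2 y hyS z hzS hyz
  have hle : S.card + 1 ≤ 5 ^ Module.finrank ℝ E := by
    obtain ⟨S', hS', h1', h2'⟩ := hQ'
    rw [← hS']
    exact hbound S' h1' h2'
  have := Nat.le_findGreatest hle hQ'
  omega

variable {d : ℕ}

/-- The operator norm is controlled by the bilinear form on a `1/2`-net. -/
lemma norm_le_of_net {S : Finset (EuclideanSpace ℝ (Fin d))}
    (hS : ∀ x : EuclideanSpace ℝ (Fin d), ‖x‖ ≤ 1 → ∃ y ∈ S, ‖x - y‖ ≤ 1 / 2)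
    (D : Matrix (Fin d) (Fin d) ℝ) {t : ℝ} (ht : 0 ≤ t)
    (h : ∀ x ∈ S, ∀ y ∈ S, inner ℝ y (act D x) ≤ t) : ‖D‖ ≤ 4 * t := by
  have h1 : ∀ x ∈ S, ‖act D x‖ ≤ 2 * t := by
    intro x hx
    rcases eq_or_ne (act D x) 0 with h0 | h0
    · rw [h0, norm_zero]
      linarith
    have hpos : 0 < ‖act D x‖ := norm_pos_iff.2 h0
    obtain ⟨y, hy, hxy⟩ := hS (‖act D x‖⁻¹ • act D x)
      (by rw [norm_smul, norm_inv, norm_norm, inv_mul_cancel₀ hpos.ne'])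
    have e1 : inner ℝ (‖act D x‖⁻¹ • act D x) (act D x) = ‖act D x‖ := by
      rw [real_inner_smul_left, real_inner_self_eq_norm_sq]
      field_simp
    have e2 : inner ℝ (‖act D x‖⁻¹ • act D x) (act D x)
        = inner ℝ y (act D x) + inner ℝ (‖act D x‖⁻¹ • act D x - y) (act D x) := by
      rw [← inner_add_left, add_sub_cancel]
    have e3 := real_inner_le_norm (‖act D x‖⁻¹ • act D x - y) (act D x)
    have e4 := h x hx y hy
    nlinarith
  -- A unit vector is a net point plus a remainder of norm at most `1/2`; the resulting `‖D‖ / 2` is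
  -- absorbed on the left.
  have h2 : ‖D‖ ≤ 2 * t + ‖D‖ / 2 := by
    rw [Matrix.l2_opNorm_def]
    refine ContinuousLinearMap.opNorm_le_of_unit_norm (by positivity) fun z hz => ?_
    rw [← Matrix.l2_opNorm_def]
    change ‖act D z‖ ≤ _
    obtain ⟨y, hy, hzy⟩ := hS z hz.le
    have : act D z = act D y + act D (z - y) := by
      simp [act, Matrix.mulVec_sub]
    rw [this]
    refine (norm_add_le _ _).trans (add_le_add (h1 y hy) ((norm_act_le _ _).trans ?_))
    nlinarith [norm_nonneg D]
  linarith

end Nets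

/-! ### Products of Gaussian layers stay near the identity -/

section GaussianBlocks

open MeasureTheory ProbabilityTheory

variable {L d : ℕ}

/-- The `k`-th layer of an array of weights, extended by zero to all natural numbers `k`. -/
def noise (N : Fin L × Fin d × Fin d → ℝ) (k : ℕ) : Matrix (Fin d) (Fin d) ℝ :=
  if h : k < L then Matrix.of fun i j => N (⟨k, h⟩, i, j) else 0

/-- The product of the `j` factors `1 + σ N_kᵀ` with `i₀ ≤ k < i₀ + j`. -/
def noiseProd (σ : ℝ) (N : Fin L × Fin d × Fin d → ℝ) (i₀ j : ℕ) : Matrix (Fin d) (Fin d) ℝ :=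
  runProd (fun i => 1 + σ • (noise N (i₀ + i))ᵀ) j

lemma continuous_noise (k : ℕ) :
    Continuous fun N : Fin L × Fin d × Fin d → ℝ => noise N k := by
  unfold noise
  split_ifs with h
  · exact continuous_matrix fun i j => continuous_apply _
  · exact continuous_const

lemma continuous_noiseProd (σ : ℝ) (i₀ j : ℕ) :
    Continuous fun N : Fin L × Fin d × Fin d → ℝ => noiseProd σ N i₀ j := by
  induction j with
  | zero => simpa [noiseProd] using continuous_const
  | succ j ih =>
    simp only [noiseProd, runProd_succ] at ih ⊢
    exact ih.mul (continuous_const.add ((continuous_noise _).matrix_transpose.const_smul σ))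

lemma noise_congr {N N' : Fin L × Fin d × Fin d → ℝ} {k : ℕ}
    (h : ∀ a : Fin L × Fin d × Fin d, (a.1 : ℕ) = k → N a = N' a) : noise N k = noise N' k := by
  unfold noise
  split_ifs with hk
  · ext i j
    exact h _ rfl
  · rfl

lemma noiseProd_congr (σ : ℝ) {N N' : Fin L × Fin d × Fin d → ℝ} {i₀ j : ℕ}
    (h : ∀ a : Fin L × Fin d × Fin d, (a.1 : ℕ) < i₀ + j → N a = N' a) :
    noiseProd σ N i₀ j = noiseProd σ N' i₀ j := by
  refine runProd_congr fun i hi => ?_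
  rw [noise_congr fun a ha => h a (by omega)]

/-- Up to the step `j`, the product has stayed close to `1`. -/
def Tame (σ : ℝ) (N : Fin L × Fin d × Fin d → ℝ) (i₀ j : ℕ) : Prop :=
  ∀ i ≤ j, ‖noiseProd σ N i₀ i - 1‖ ≤ 1 / 2

lemma isClosed_tame (σ : ℝ) (i₀ j : ℕ) :
    IsClosed {N : Fin L × Fin d × Fin d → ℝ | Tame σ N i₀ j} := by
  simp only [Tame, Set.ofPred_forall]
  exact isClosed_iInter fun i => isClosed_iInter fun _ =>
    isClosed_le ((continuous_noiseProd σ i₀ i).sub continuous_const).norm continuous_const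

open Classical in
/-- The vector on which the `k`-th layer acts, set to zero as soon as the product is far
from `1`. -/
def stoppedVec (σ : ℝ) (i₀ m : ℕ) (y : EuclideanSpace ℝ (Fin d)) (k : ℕ)
    (N : Fin L × Fin d × Fin d → ℝ) : EuclideanSpace ℝ (Fin d) :=
  if i₀ ≤ k ∧ k < i₀ + m ∧ Tame σ N i₀ (k - i₀) then act (noiseProd σ N i₀ (k - i₀))ᵀ y else 0

lemma measurable_stoppedVec (σ : ℝ) (i₀ m : ℕ) (y : EuclideanSpace ℝ (Fin d)) (k : ℕ)
    (l : Fin d) :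
    Measurable fun N : Fin L × Fin d × Fin d → ℝ => stoppedVec σ i₀ m y k N l := by
  classical
  have h : ∀ N : Fin L × Fin d × Fin d → ℝ, stoppedVec σ i₀ m y k N l
      = if (i₀ ≤ k ∧ k < i₀ + m) ∧ Tame σ N i₀ (k - i₀) then
          ∑ i, noiseProd σ N i₀ (k - i₀) i l * y i else 0 := by
    intro N
    unfold stoppedVec
    simp only [and_assoc]
    split_ifs <;> simp [Matrix.mulVec, dotProduct]
  simp_rw [h]
  refine Measurable.ite ?_ ?_ measurable_const
  · exact MeasurableSet.inter (MeasurableSet.const _) (isClosed_tame σ i₀ _).measurableSet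
  · refine Finset.measurable_sum _ fun i _ => Measurable.mul_const ?_ _
    exact ((continuous_noiseProd σ i₀ _).matrix_elem i l).measurable

/-- Predictability, as required by `lintegral_exp_predictable`: stopping at layer `k` is decided by
the layers before `k`. -/
lemma stoppedVec_congr (σ : ℝ) (i₀ m : ℕ) (y : EuclideanSpace ℝ (Fin d)) (k : ℕ)
    {N N' : Fin L × Fin d × Fin d → ℝ}
    (h : ∀ a : Fin L × Fin d × Fin d, (a.1 : ℕ) < k → N a = N' a) :
    stoppedVec σ i₀ m y k N = stoppedVec σ i₀ m y k N' := by
  unfold stoppedVec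
  by_cases hk : i₀ ≤ k
  · have e : ∀ i ≤ k - i₀, noiseProd σ N i₀ i = noiseProd σ N' i₀ i := fun i hi =>
      noiseProd_congr σ fun a ha => h a (by omega)
    have : Tame σ N i₀ (k - i₀) ↔ Tame σ N' i₀ (k - i₀) :=
      forall₂_congr fun i hi => by rw [e i hi]
    rw [e _ le_rfl]
    by_cases ht : Tame σ N' i₀ (k - i₀)
    · have ht' := this.2 ht
      simp [ht, ht']
    · have ht' : ¬ Tame σ N i₀ (k - i₀) := fun h => ht (this.1 h)
      simp [ht, ht']
  · simp [hk]

/-- Thanks to the stopping this bound is deterministic, which is what controls the compensator of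
the exponential martingale. -/
lemma norm_stoppedVec_le (σ : ℝ) (i₀ m : ℕ) {y : EuclideanSpace ℝ (Fin d)} (hy : ‖y‖ ≤ 1)
    (k : ℕ) (N : Fin L × Fin d × Fin d → ℝ) : ‖stoppedVec σ i₀ m y k N‖ ≤ 2 := by
  unfold stoppedVec
  split_ifs with h
  · have h1 := h.2.2 _ le_rfl
    have h2 : ‖noiseProd σ N i₀ (k - i₀)‖ ≤ 2 := by
      calc ‖noiseProd σ N i₀ (k - i₀)‖ = ‖(noiseProd σ N i₀ (k - i₀) - 1) + 1‖ := by simp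
        _ ≤ ‖noiseProd σ N i₀ (k - i₀) - 1‖ + ‖(1 : Matrix (Fin d) (Fin d) ℝ)‖ := norm_add_le _ _
        _ ≤ 2 := by linarith [norm_one_matrix_le (d := d)]
    refine (norm_act_le _ _).trans ?_
    rw [norm_transpose_matrix]
    nlinarith [norm_nonneg y]
  · simp

/-- The increments of the stopped product sum up to its distance from `1`. -/
lemma sum_inner_stoppedVec (σ : ℝ) (i₀ m j : ℕ) (x y : EuclideanSpace ℝ (Fin d))
    (N : Fin L × Fin d × Fin d → ℝ) (hj : j ≤ m) (hjt : ∀ i < j, Tame σ N i₀ i)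
    (hjn : ¬ Tame σ N i₀ j) :
    ∑ k ∈ Finset.range L, σ * inner ℝ x (act (noise N k) (stoppedVec σ i₀ m y k N))
      = inner ℝ y (act (noiseProd σ N i₀ j - 1) x) := by
  classical
  have h1 : ∑ k ∈ Finset.range L, σ * inner ℝ x (act (noise N k) (stoppedVec σ i₀ m y k N))
      = ∑ k ∈ Finset.Ico i₀ (i₀ + j),
        σ * inner ℝ x (act (noise N k) (stoppedVec σ i₀ m y k N)) := by
    -- Tameness at a later index would imply tameness at `j`, so the stopped vector vanishes from
    -- `i₀ + j` on; for `k ≥ L` the noise itself is zero.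
    refine Finset.sum_congr_of_eq_on_inter ?_ ?_ ?_
    · intro k _ hk
      have : stoppedVec σ i₀ m y k N = 0 := by
        unfold stoppedVec
        rw [if_neg]
        rintro ⟨h1, h2, h3⟩
        rw [Finset.mem_Ico, not_and, not_lt] at hk
        have := hk h1
        exact hjn fun i hi => h3 i (by omega)
      simp [this, act]
    · intro k _ hk
      have : noise N k = 0 := by
        unfold noise
        rw [dif_neg]
        simpa using hk
      simp [this, act]
    · intros; rfl
  have h2 : ∀ n ≤ j, ∑ k ∈ Finset.Ico i₀ (i₀ + n),
      σ * inner ℝ x (act (noise N k) (stoppedVec σ i₀ m y k N))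
        = inner ℝ y (act (noiseProd σ N i₀ n - 1) x) := by
    intro n hn
    induction n with
    | zero => simp [noiseProd, act]
    | succ n ih =>
      rw [← add_assoc, Finset.sum_Ico_succ_top (by omega), ih (by omega)]
      have hv : stoppedVec σ i₀ m y (i₀ + n) N = act (noiseProd σ N i₀ n)ᵀ y := by
        unfold stoppedVec
        rw [if_pos]
        · simp
        · exact ⟨by omega, by omega, by simpa using hjt n (by omega)⟩
      -- The increment of the product is `σ M_n N_nᵀ`; transposing moves `M_n` onto `y`, so the
      -- fresh noise `N_n` is paired with a vector determined by the past.
      have hM : noiseProd σ N i₀ (n + 1) - 1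
          = (noiseProd σ N i₀ n - 1) + σ • (noiseProd σ N i₀ n * (noise N (i₀ + n))ᵀ) := by
        simp only [noiseProd, runProd_succ, mul_add, mul_one, Matrix.mul_smul]
        abel
      have hact : ∀ (A B : Matrix (Fin d) (Fin d) ℝ), act (A + σ • B) x = act A x + σ • act B x := by
        intro A B
        simp [act, Matrix.add_mulVec, Matrix.smul_mulVec]
      have hflip : inner ℝ x (act (noise N (i₀ + n)) (act (noiseProd σ N i₀ n)ᵀ y))
          = inner ℝ y (act (noiseProd σ N i₀ n * (noise N (i₀ + n))ᵀ) x) := by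
        rw [act_mul, inner_act (noise N (i₀ + n)) x, inner_act (noiseProd σ N i₀ n) y,
          real_inner_comm]
      rw [hv, hM, hact, inner_add_right, inner_smul_right, hflip]
  rw [h1, h2 j le_rfl]

lemma inner_act_eq_sum (A : Matrix (Fin d) (Fin d) ℝ) (x v : EuclideanSpace ℝ (Fin d)) :
    inner ℝ x (act A v) = ∑ i, ∑ j, x i * v j * A i j := by
  simp only [PiLp.inner_apply, act, Matrix.mulVec, dotProduct, RCLike.inner_apply, conj_trivial]
  refine Finset.sum_congr rfl fun i _ => ?_
  rw [Finset.sum_mul]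
  exact Finset.sum_congr rfl fun j _ => by ring

variable {Ω : Type*} [MeasurableSpace Ω] {P : Measure Ω}

/-- The exponent of the stopped exponential martingale. -/
def stoppedExponent (σ θ : ℝ) (i₀ m : ℕ) (x y : EuclideanSpace ℝ (Fin d))
    (N : Fin L × Fin d × Fin d → ℝ) : ℝ :=
  ∑ k ∈ Finset.range L, (θ * (σ * inner ℝ x (act (noise N k) (stoppedVec σ i₀ m y k N)))
    - (θ * σ) ^ 2 * ‖x‖ ^ 2 * ‖stoppedVec σ i₀ m y k N‖ ^ 2 / 2)

/-- The rank is the layer number, and the entry `(i, l)` of layer `k` gets the coefficient `θ σ x_i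
v_l`, with `v` the stopped vector. The squares of these coefficients sum to `(θ σ)² ‖x‖² ‖v‖²`. -/
lemma lintegral_exp_stoppedExponent {X : Fin L × Fin d × Fin d → Ω → ℝ}
    (hX : ∀ a, Measurable (X a)) (hlaw : ∀ a, P.map (X a) = gaussianReal 0 1)
    (hind : iIndepFun X P) (σ θ : ℝ) (i₀ m : ℕ) (x y : EuclideanSpace ℝ (Fin d)) :
    ∫⁻ ω, ENNReal.ofReal (Real.exp
      (stoppedExponent σ θ i₀ m x y fun a => X a ω)) ∂P = 1 := by
  have h := lintegral_exp_predictable hX hlaw hind (fun a => (a.1 : ℕ))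
    (fun a N => θ * σ * x a.2.1 * stoppedVec σ i₀ m y a.1 N a.2.2)
    (fun a => (measurable_stoppedVec σ i₀ m y a.1 a.2.2).const_mul _)
    (fun a N N' h => by rw [stoppedVec_congr σ i₀ m y _ h]) L
  convert h using 5 with ω
  have huniv : (Finset.univ.filter fun a : Fin L × Fin d × Fin d => (a.1 : ℕ) < L)
      = Finset.univ := Finset.filter_true_of_mem fun a _ => a.1.2
  rw [huniv, stoppedExponent, Finset.sum_range, Fintype.sum_prod_type]
  refine Finset.sum_congr rfl fun k _ => ?_
  rw [Fintype.sum_prod_type, inner_act_eq_sum, EuclideanSpace.real_norm_sq_eq x,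
    EuclideanSpace.real_norm_sq_eq]
  simp only [Finset.sum_sub_distrib]
  congr 1
  · simp only [Finset.mul_sum]
    refine Finset.sum_congr rfl fun i _ => Finset.sum_congr rfl fun j _ => ?_
    simp only [noise, k.2, dif_pos, Matrix.of_apply]
    ring
  · rw [mul_assoc, Finset.sum_mul_sum, Finset.mul_sum, Finset.sum_div]
    refine Finset.sum_congr rfl fun i _ => ?_
    rw [Finset.mul_sum, Finset.sum_div]
    refine Finset.sum_congr rfl fun j _ => ?_
    ring

lemma measurable_stoppedExponent (σ θ : ℝ) (i₀ m : ℕ) (x y : EuclideanSpace ℝ (Fin d)) :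
    Measurable fun N : Fin L × Fin d × Fin d → ℝ => stoppedExponent σ θ i₀ m x y N := by
  unfold stoppedExponent
  refine Finset.measurable_sum _ fun k _ => ?_
  simp_rw [inner_act_eq_sum, EuclideanSpace.real_norm_sq_eq]
  have h1 := fun l => measurable_stoppedVec (L := L) σ i₀ m y k l
  have h2 := fun i l => ((continuous_noise (L := L) (d := d) k).matrix_elem i l).measurable
  refine Measurable.sub (Measurable.const_mul (Measurable.const_mul ?_ _) _)
    (Measurable.div_const (Measurable.const_mul ?_ _) _)
  · exact Finset.measurable_sum _ fun i _ => Finset.measurable_sum _ fun l _ =>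
      ((h1 l).const_mul _).mul (h2 i l)
  · exact Finset.measurable_sum _ fun l _ => (h1 l).pow_const 2

/-- The exponent is large if the product leaves the ball of radius `1 / 2` around `1`. -/
lemma le_stoppedExponent {σ θ : ℝ} (hθ : 0 ≤ θ) (i₀ m : ℕ) {x y : EuclideanSpace ℝ (Fin d)}
    (hx : ‖x‖ ≤ 1) (hy : ‖y‖ ≤ 1) (N : Fin L × Fin d × Fin d → ℝ) {j : ℕ} (hj : j ≤ m)
    (hjt : ∀ i < j, Tame σ N i₀ i) (hjn : ¬ Tame σ N i₀ j)
    (hxy : 1 / 8 ≤ inner ℝ y (act (noiseProd σ N i₀ j - 1) x)) :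
    θ / 8 - 2 * θ ^ 2 * σ ^ 2 * m ≤ stoppedExponent σ θ i₀ m x y N := by
  unfold stoppedExponent
  rw [Finset.sum_sub_distrib, ← Finset.mul_sum, sum_inner_stoppedVec σ i₀ m j x y N hj hjt hjn]
  -- At most `m` layers contribute, each at most `(θ σ)² * 1 * 2² / 2`.
  have hcomp : ∑ k ∈ Finset.range L,
      (θ * σ) ^ 2 * ‖x‖ ^ 2 * ‖stoppedVec σ i₀ m y k N‖ ^ 2 / 2 ≤ 2 * θ ^ 2 * σ ^ 2 * m := by
    calc ∑ k ∈ Finset.range L, (θ * σ) ^ 2 * ‖x‖ ^ 2 * ‖stoppedVec σ i₀ m y k N‖ ^ 2 / 2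
        ≤ ∑ k ∈ Finset.range L,
            if k ∈ Finset.Ico i₀ (i₀ + m) then (θ * σ) ^ 2 * 1 * 4 / 2 else 0 := by
          refine Finset.sum_le_sum fun k _ => ?_
          split_ifs with hk
          · have h2 := norm_stoppedVec_le σ i₀ m hy k N
            gcongr
            · exact pow_le_one₀ (norm_nonneg _) hx
            · nlinarith [norm_nonneg (stoppedVec σ i₀ m y k N)]
          · have : stoppedVec σ i₀ m y k N = 0 := by
              unfold stoppedVec
              rw [if_neg]
              rintro ⟨h1, h2, -⟩
              exact hk (Finset.mem_Ico.2 ⟨h1, h2⟩)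
            simp [this]
      _ ≤ ∑ k ∈ Finset.Ico i₀ (i₀ + m), (θ * σ) ^ 2 * 1 * 4 / 2 := by
          rw [← Finset.sum_filter]
          refine Finset.sum_le_sum_of_subset_of_nonneg ?_ fun _ _ _ => by positivity
          intro k hk
          exact (Finset.mem_filter.1 hk).2
      _ = 2 * θ ^ 2 * σ ^ 2 * m := by
          rw [Finset.sum_const, Nat.card_Ico, nsmul_eq_mul]
          push_cast [Nat.add_sub_cancel_left]
          ring
  nlinarith

/-- With high probability, the product of few layers stays close to `1`. -/
lemma measure_not_tame_le {X : Fin L × Fin d × Fin d → Ω → ℝ}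
    (hX : ∀ a, Measurable (X a)) (hlaw : ∀ a, P.map (X a) = gaussianReal 0 1)
    (hind : iIndepFun X P) (σ : ℝ) (i₀ m : ℕ) (hσ : 8192 * σ ^ 2 * m * d ≤ 1) :
    P {ω | ¬ Tame σ (fun a => X a ω) i₀ m} ≤ ENNReal.ofReal (Real.exp (-3 * d)) := by
  classical
  obtain ⟨S, hcard, hS1, hS⟩ := exists_half_net (EuclideanSpace ℝ (Fin d))
  rw [finrank_euclideanSpace_fin] at hcard
  -- Then `θ / 8 = 8 d`, while the compensator is at most `8192 σ² m d² ≤ d`, so an exit forces the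
  -- exponent to be at least `7 d`. Markov gives `exp (-7 d)` for each pair, and there are at most
  -- `25 ^ d ≤ exp (4 d)` pairs of net points.
  set θ : ℝ := 64 * d with hθ
  have hsub : {ω | ¬ Tame σ (fun a => X a ω) i₀ m} ⊆
      ⋃ q ∈ S ×ˢ S, {ω | ENNReal.ofReal (Real.exp (7 * d)) ≤
        ENNReal.ofReal (Real.exp (stoppedExponent σ θ i₀ m q.1 q.2 fun a => X a ω))} := by
    intro ω hω
    set N : Fin L × Fin d × Fin d → ℝ := fun a => X a ω with hN
    have hex : ∃ j, ¬ Tame σ N i₀ j := ⟨m, hω⟩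
    have hjm : Nat.find hex ≤ m := Nat.find_min' hex hω
    have hjt : ∀ i < Nat.find hex, Tame σ N i₀ i := fun i hi => not_not.1 (Nat.find_min hex hi)
    have hjn := Nat.find_spec hex
    set j := Nat.find hex with hj
    -- At the first non-tame time the violation must occur at the last index, since all earlier ones
    -- are tame.
    have hbig : 1 / 2 < ‖noiseProd σ N i₀ j - 1‖ := by
      by_contra hle
      rw [not_lt] at hle
      refine hjn fun i hi => ?_
      rcases hi.lt_or_eq with hi | rfl
      · exact hjt i hi i le_rfl
      · exact hle
    -- The threshold `1/8` is the radius `1/2` divided by the factor `4` lost in `norm_le_of_net`.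
    have : ∃ x ∈ S, ∃ y ∈ S, 1 / 8 ≤ inner ℝ y (act (noiseProd σ N i₀ j - 1) x) := by
      by_contra! hcon
      have := norm_le_of_net hS (noiseProd σ N i₀ j - 1) (t := 1 / 8) (by norm_num)
        fun x hx y hy => (hcon x hx y hy).le
      linarith
    obtain ⟨x, hx, y, hy, hxy⟩ := this
    rw [Set.mem_iUnion₂]
    refine ⟨(x, y), Finset.mem_product.2 ⟨hx, hy⟩, ?_⟩
    refine ENNReal.ofReal_le_ofReal (Real.exp_le_exp.2 ?_)
    refine le_trans ?_ (le_stoppedExponent (σ := σ) (θ := θ) (by positivity) i₀ m (hS1 x hx)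
      (hS1 y hy) N hjm hjt hjn hxy)
    have hd : (0 : ℝ) ≤ d := Nat.cast_nonneg d
    rw [hθ]
    nlinarith [mul_le_mul_of_nonneg_left hσ hd]
  refine (measure_mono hsub).trans ((measure_biUnion_finset_le _ _).trans ?_)
  have hone : ∀ q ∈ S ×ˢ S, P {ω | ENNReal.ofReal (Real.exp (7 * d)) ≤
        ENNReal.ofReal (Real.exp (stoppedExponent σ θ i₀ m q.1 q.2 fun a => X a ω))}
      ≤ ENNReal.ofReal (Real.exp (-7 * d)) := by
    intro q _
    have hmeas : Measurable fun ω => ENNReal.ofReal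
        (Real.exp (stoppedExponent σ θ i₀ m q.1 q.2 fun a => X a ω)) :=
      ((measurable_stoppedExponent σ θ i₀ m q.1 q.2).comp
        (measurable_pi_lambda _ hX)).exp.ennreal_ofReal
    have h := meas_ge_le_lintegral_div (μ := P) hmeas.aemeasurable
      (ε := ENNReal.ofReal (Real.exp (7 * d))) (by simp [Real.exp_pos]) ENNReal.ofReal_ne_top
    rw [lintegral_exp_stoppedExponent hX hlaw hind, one_div,
      ← ENNReal.ofReal_inv_of_pos (Real.exp_pos _), ← Real.exp_neg, ← neg_mul] at h
    exact h
  refine (Finset.sum_le_sum hone).trans ?_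
  rw [Finset.sum_const, nsmul_eq_mul, Finset.card_product, ← ENNReal.ofReal_natCast,
    ← ENNReal.ofReal_mul (by positivity)]
  refine ENNReal.ofReal_le_ofReal ?_
  have h25 : ((S.card * S.card : ℕ) : ℝ) ≤ Real.exp (4 * d) := by
    have h5 : (S.card : ℝ) ≤ 5 ^ d := by exact_mod_cast hcard
    have he : (5 : ℝ) ≤ Real.exp 2 := by
      have := Real.exp_one_gt_d9
      have h2 : Real.exp 2 = Real.exp 1 * Real.exp 1 := by rw [← Real.exp_add]; norm_num
      rw [h2]
      nlinarith
    calc ((S.card * S.card : ℕ) : ℝ) = S.card * S.card := by push_cast; ring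
      _ ≤ 5 ^ d * 5 ^ d := by gcongr
      _ ≤ Real.exp 2 ^ d * Real.exp 2 ^ d := by gcongr
      _ = Real.exp (4 * d) := by
        rw [← Real.exp_nat_mul, ← Real.exp_add]
        ring_nf
  calc ((S.card * S.card : ℕ) : ℝ) * Real.exp (-7 * d)
      ≤ Real.exp (4 * d) * Real.exp (-7 * d) := by gcongr
    _ = Real.exp (-3 * d) := by
      rw [← Real.exp_add]
      ring_nf

/-- With high probability, all initial products of the random layers are well conditioned. -/
lemma exists_goodEvent {X : Fin L × Fin d × Fin d → Ω → ℝ} [IsProbabilityMeasure P]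
    (hX : ∀ a, Measurable (X a)) (hlaw : ∀ a, P.map (X a) = gaussianReal 0 1)
    (hind : iIndepFun X P) (σ : ℝ) (m B : ℕ) (hσ : 8192 * σ ^ 2 * m * d ≤ 1)
    (hB : Real.log B ≤ 2 * d) (hB0 : 0 < B) :
    ∃ E : Set Ω, MeasurableSet E ∧ 1 - 16 * Real.exp (-1 * (d : ℝ)) ≤ P.real E ∧
      ∀ ω ∈ E, ∀ k ≤ B * m, BddUnit (2 ^ B)
        (runProd (fun i => 1 + σ • (noise (fun a => X a ω) i)ᵀ) k) := by
  let E : Set Ω := {ω | ∀ b < B, Tame σ (fun a => X a ω) (b * m) m}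
  have hE : MeasurableSet E := by
    simp only [E, Set.ofPred_forall]
    exact MeasurableSet.iInter fun b => MeasurableSet.iInter fun _ =>
      (isClosed_tame σ (b * m) m).measurableSet.preimage (measurable_pi_lambda _ hX)
  refine ⟨E, hE, ?_, fun ω hω k hk => ?_⟩
  · have hc : P Eᶜ ≤ ENNReal.ofReal (Real.exp (-1 * d)) := by
      have hsub : Eᶜ ⊆ ⋃ b ∈ Finset.range B, {ω | ¬ Tame σ (fun a => X a ω) (b * m) m} := by
        intro ω hω
        simp only [E, Set.mem_compl_iff, Set.mem_ofPred_eq, not_forall] at hω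
        obtain ⟨b, hb, h⟩ := hω
        exact Set.mem_iUnion₂.2 ⟨b, Finset.mem_range.2 hb, h⟩
      refine (measure_mono hsub).trans ((measure_biUnion_finset_le _ _).trans
        ((Finset.sum_le_sum fun b _ => measure_not_tame_le hX hlaw hind σ (b * m) m hσ).trans ?_))
      rw [Finset.sum_const, nsmul_eq_mul, Finset.card_range, ← ENNReal.ofReal_natCast,
        ← ENNReal.ofReal_mul (by positivity)]
      refine ENNReal.ofReal_le_ofReal ?_
      -- The union over the blocks costs `B ≤ exp (2 d)`, leaving `exp (-d)`; the factor `16` of the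
      -- conclusion is slack.
      have hB' : (B : ℝ) ≤ Real.exp (2 * d) := by
        rwa [← Real.log_le_iff_le_exp (by exact_mod_cast hB0)]
      calc (B : ℝ) * Real.exp (-3 * d) ≤ Real.exp (2 * d) * Real.exp (-3 * d) := by gcongr
        _ = Real.exp (-1 * d) := by
          rw [← Real.exp_add]
          ring_nf
    have hr : P.real Eᶜ ≤ Real.exp (-1 * d) :=
      ENNReal.toReal_le_of_le_ofReal (Real.exp_pos _).le hc
    rw [probReal_compl_eq_one_sub hE] at hr
    linarith [Real.exp_pos (-1 * (d : ℝ))]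
  · have hω' : ∀ b < B, Tame σ (fun a => X a ω) (b * m) m := hω
    refine bddUnit_runProd_of_blocks norm_one_matrix_le
      (fun i => 1 + σ • (noise (fun a => X a ω) i)ᵀ) m B ?_ k hk
    intro b hb j hj
    have h := hω' b hb j hj
    rwa [noiseProd] at h

end GaussianBlocks

/-! ### The network, its Jacobian and the adjoint -/

section Network

variable {L d : ℕ}

/-- The transposed layers, extended by the identity to all natural numbers. -/
def layersT (V : Param L d) (k : ℕ) : Matrix (Fin d) (Fin d) ℝ :=
  if h : k < L then (layer V ⟨k, h⟩)ᵀ else 1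

/-- The product `W_1ᵀ ⋯ W_kᵀ` of the first `k` transposed layers. -/
def headProd (V : Param L d) (k : ℕ) : Matrix (Fin d) (Fin d) ℝ := runProd (layersT V) k

/-- The product `W_{k+1}ᵀ ⋯ W_Lᵀ` of all but the first `k` transposed layers. -/
def tailProd (V : Param L d) (k : ℕ) : Matrix (Fin d) (Fin d) ℝ :=
  runProd (fun j => layersT V (k + j)) (L - k)

lemma prod_ofFn_eq_runProd {M : Type*} [Monoid M] (f : Fin L → M) :
    (List.ofFn f).prod = runProd (fun k => if h : k < L then f ⟨k, h⟩ else 1) L := by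
  unfold runProd
  congr 1
  refine List.ext_getElem (by simp) fun i h1 h2 => ?_
  have : i < L := by simpa using h1
  simp [this]

lemma wProd_eq_act_headProd (p : EuclideanSpace ℝ (Fin d)) (V : Param L d) :
    wProd p V = act (headProd V L) p := by
  unfold wProd headProd
  rw [prod_ofFn_eq_runProd]
  rfl

lemma headProd_mul_tailProd (V : Param L d) {k : ℕ} (hk : k ≤ L) :
    headProd V k * tailProd V k = headProd V L := by
  unfold headProd tailProd
  rw [← runProd_add, Nat.add_sub_cancel' hk]

lemma tailProd_self (V : Param L d) : tailProd V L = 1 := by simp [tailProd]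

/-- The derivative of an ordered product in one factor replaces that factor; this exhibits what
remains on either side of it. -/
lemma prod_ofFn_update (V : Param L d) (k : Fin L) (C : Matrix (Fin d) (Fin d) ℝ) :
    (List.ofFn (Function.update (fun j => (layer V j)ᵀ) k C)).prod
      = headProd V k * C * tailProd V (k + 1) := by
  rw [prod_ofFn_eq_runProd]
  set a : ℕ → Matrix (Fin d) (Fin d) ℝ := fun j =>
    if h : j < L then Function.update (fun j => (layer V j)ᵀ) k C ⟨j, h⟩ else 1 with ha
  have hne : ∀ j, j ≠ (k : ℕ) → a j = layersT V j := by
    intro j hj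
    simp only [ha, layersT]
    split_ifs with h
    · rw [Function.update_of_ne]
      exact fun h' => hj (congrArg Fin.val h')
    · rfl
  have hk : a k = C := by simp [ha]
  have hL : L = (k + 1) + (L - (k + 1)) := by omega
  have h1 : runProd a L = runProd a (k + 1) * runProd (fun j => a (k + 1 + j)) (L - (k + 1)) := by
    rw [← runProd_add, ← hL]
  rw [h1, runProd_succ, hk]
  congr 1
  · congr 1
    exact runProd_congr fun j hj => hne j (by omega)
  · exact runProd_congr fun j hj => hne _ (by omega)

/-- The transposed layers, as a linear function of the parameters. -/
def layersLM (L d : ℕ) : Param L d →L[ℝ] (Fin L → Matrix (Fin d) (Fin d) ℝ) :=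
  LinearMap.toContinuousLinearMap
    { toFun := fun V k => (layer V k)ᵀ
      map_add' := fun _ _ => rfl
      map_smul' := fun _ _ => rfl }

/-- Evaluation of a matrix on a fixed vector. -/
def evalLM (p : EuclideanSpace ℝ (Fin d)) :
    Matrix (Fin d) (Fin d) ℝ →L[ℝ] EuclideanSpace ℝ (Fin d) :=
  LinearMap.toContinuousLinearMap
    { toFun := fun A => act A p
      map_add' := fun A B => by simp [act, Matrix.add_mulVec]
      map_smul' := fun c A => by simp [act, Matrix.smul_mulVec] }

/-- The action of a fixed matrix. -/
def actLM (A : Matrix (Fin d) (Fin d) ℝ) :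
    EuclideanSpace ℝ (Fin d) →L[ℝ] EuclideanSpace ℝ (Fin d) :=
  LinearMap.toContinuousLinearMap
    { toFun := fun x => act A x
      map_add' := fun x y => by simp [act, Matrix.mulVec_add]
      map_smul' := fun c x => by simp [act, Matrix.mulVec_smul] }

@[simp] lemma actLM_apply (A : Matrix (Fin d) (Fin d) ℝ) (x : EuclideanSpace ℝ (Fin d)) :
    actLM A x = act A x := rfl

/-- Linear after multilinear after linear: both smoothness and the derivative of the network are
read off from this form. -/
lemma wProd_eq_comp (p : EuclideanSpace ℝ (Fin d)) :
    (wProd p : Param L d → EuclideanSpace ℝ (Fin d)) = fun V => evalLM p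
      (ContinuousMultilinearMap.mkPiAlgebraFin ℝ L (Matrix (Fin d) (Fin d) ℝ) (layersLM L d V)) := by
  funext V
  rw [ContinuousMultilinearMap.mkPiAlgebraFin_apply]
  rfl

lemma contDiff_wProd (p : EuclideanSpace ℝ (Fin d)) {n : WithTop ℕ∞} :
    ContDiff ℝ n (wProd p : Param L d → EuclideanSpace ℝ (Fin d)) := by
  rw [wProd_eq_comp]
  exact (evalLM p).contDiff.comp
    ((ContinuousMultilinearMap.contDiff _).comp (layersLM L d).contDiff)

/-- The derivative of the network with respect to its weights. -/
def wJac (p : EuclideanSpace ℝ (Fin d)) (V : Param L d) :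
    Param L d →L[ℝ] EuclideanSpace ℝ (Fin d) := fderiv ℝ (wProd p) V

lemma hasFDerivAt_wProd (p : EuclideanSpace ℝ (Fin d)) (V : Param L d) :
    HasFDerivAt (wProd p) (wJac p V) V :=
  ((contDiff_wProd p (n := 1)).differentiable one_ne_zero V).hasFDerivAt

lemma contDiff_wJac (p : EuclideanSpace ℝ (Fin d)) :
    ContDiff ℝ 1 (wJac p : Param L d → Param L d →L[ℝ] EuclideanSpace ℝ (Fin d)) :=
  (contDiff_wProd p (n := 2)).fderiv_right (by norm_num)

lemma wJac_apply (p : EuclideanSpace ℝ (Fin d)) (V δ : Param L d) :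
    wJac p V δ = ∑ k : Fin L,
      act (headProd V k) (act (layer δ k)ᵀ (act (tailProd V (k + 1)) p)) := by
  set M := ContinuousMultilinearMap.mkPiAlgebraFin ℝ L (Matrix (Fin d) (Fin d) ℝ) with hM
  have h1 : HasFDerivAt (fun V => M (layersLM L d V))
      ((M.linearDeriv (layersLM L d V)).comp (layersLM L d)) V :=
    (M.hasFDerivAt (layersLM L d V)).comp V (layersLM L d).hasFDerivAt
  have h2 : HasFDerivAt (wProd p)
      ((evalLM p).comp ((M.linearDeriv (layersLM L d V)).comp (layersLM L d))) V := by
    rw [wProd_eq_comp]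
    exact (evalLM p).hasFDerivAt.comp V h1
  rw [wJac, h2.fderiv]
  simp only [ContinuousLinearMap.comp_apply, ContinuousMultilinearMap.linearDeriv_apply, map_sum]
  refine Finset.sum_congr rfl fun k _ => ?_
  rw [hM, ContinuousMultilinearMap.mkPiAlgebraFin_apply]
  change act (List.ofFn (Function.update (fun j => (layer V j)ᵀ) k (layer δ k)ᵀ)).prod p = _
  rw [prod_ofFn_update, act_mul, act_mul]

/-- The adjoint of `wJac`. -/
def wJacAdj (p : EuclideanSpace ℝ (Fin d)) (V : Param L d) (u : EuclideanSpace ℝ (Fin d)) :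
    Param L d :=
  ofLayers fun k => Matrix.of fun j i => act (headProd V k)ᵀ u i * act (tailProd V (k + 1)) p j

lemma inner_param (V V' : Param L d) :
    inner ℝ V V' = ∑ k, ∑ j, ∑ i, layer V k j i * layer V' k j i := by
  simp only [PiLp.inner_apply, Fintype.sum_prod_type, RCLike.inner_apply, conj_trivial, layer,
    Matrix.of_apply, mul_comm]

lemma sq_norm_param (V : Param L d) : ‖V‖ ^ 2 = ∑ k, frobNorm (layer V k) ^ 2 := by
  rw [← real_inner_self_eq_norm_sq, inner_param]
  refine Finset.sum_congr rfl fun k _ => ?_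
  rw [frobNorm, Real.sq_sqrt (by positivity)]
  simp only [sq]

lemma inner_wJacAdj (p : EuclideanSpace ℝ (Fin d)) (V : Param L d)
    (u : EuclideanSpace ℝ (Fin d)) (δ : Param L d) :
    inner ℝ (wJacAdj p V u) δ = inner ℝ u (wJac p V δ) := by
  rw [wJac_apply, inner_sum, inner_param]
  refine Finset.sum_congr rfl fun k _ => ?_
  rw [inner_act]
  simp only [PiLp.inner_apply, act, Matrix.mulVec, dotProduct, RCLike.inner_apply, conj_trivial,
    Finset.sum_mul]
  rw [Finset.sum_comm]
  refine Finset.sum_congr rfl fun i _ => Finset.sum_congr rfl fun j _ => ?_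
  simp only [wJacAdj, layer, ofLayers, Matrix.of_apply, Matrix.transpose_apply, Matrix.mulVec,
    dotProduct]
  ring

lemma adjoint_wJac (p : EuclideanSpace ℝ (Fin d)) (V : Param L d)
    (u : EuclideanSpace ℝ (Fin d)) :
    ContinuousLinearMap.adjoint (wJac p V) u = wJacAdj p V u := by
  refine ext_inner_right ℝ fun δ => ?_
  rw [ContinuousLinearMap.adjoint_inner_left, inner_wJacAdj]

/-- Each layer of the adjoint is a rank-one matrix, so its Frobenius norm is a product of two vector
norms. -/
lemma frobNorm_layer_wJacAdj (p : EuclideanSpace ℝ (Fin d)) (V : Param L d)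
    (u : EuclideanSpace ℝ (Fin d)) (k : Fin L) :
    frobNorm (layer (wJacAdj p V u) k)
      = ‖act (headProd V k)ᵀ u‖ * ‖act (tailProd V (k + 1)) p‖ := by
  rw [EuclideanSpace.norm_eq, EuclideanSpace.norm_eq, ← Real.sqrt_mul (by positivity), frobNorm]
  congr 1
  rw [Finset.sum_mul_sum, Finset.sum_comm]
  refine Finset.sum_congr rfl fun i _ => Finset.sum_congr rfl fun j _ => ?_
  simp only [Real.norm_eq_abs, sq_abs, ← mul_pow]
  rfl

lemma sq_norm_wJacAdj (p : EuclideanSpace ℝ (Fin d)) (V : Param L d)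
    (u : EuclideanSpace ℝ (Fin d)) :
    ‖wJacAdj p V u‖ ^ 2
      = ∑ k : Fin L, (‖act (headProd V k)ᵀ u‖ * ‖act (tailProd V (k + 1)) p‖) ^ 2 := by
  rw [sq_norm_param]
  simp_rw [frobNorm_layer_wJacAdj]

/-- Taking adjoints of real operators is linear. -/
def adjointLM (E F : Type*) [NormedAddCommGroup E] [InnerProductSpace ℝ E]
    [FiniteDimensional ℝ E] [NormedAddCommGroup F] [InnerProductSpace ℝ F]
    [FiniteDimensional ℝ F] : (E →L[ℝ] F) →L[ℝ] (F →L[ℝ] E) :=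
  haveI := FiniteDimensional.complete ℝ E
  haveI := FiniteDimensional.complete ℝ F
  LinearMap.toContinuousLinearMap
    { toFun := fun A => ContinuousLinearMap.adjoint A
      map_add' := fun A B => by simp
      map_smul' := fun c A => by simp }

/-- The adjoint of `wJac`, as a linear operator. -/
def wJacAdjLM (p : EuclideanSpace ℝ (Fin d)) (V : Param L d) :
    EuclideanSpace ℝ (Fin d) →L[ℝ] Param L d := adjointLM _ _ (wJac p V)

lemma wJacAdjLM_apply (p : EuclideanSpace ℝ (Fin d)) (V : Param L d)
    (u : EuclideanSpace ℝ (Fin d)) : wJacAdjLM p V u = wJacAdj p V u := adjoint_wJac p V u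

lemma contDiff_wJacAdjLM (p : EuclideanSpace ℝ (Fin d)) :
    ContDiff ℝ 1 (wJacAdjLM p : Param L d → EuclideanSpace ℝ (Fin d) →L[ℝ] Param L d) :=
  (adjointLM (Param L d) (EuclideanSpace ℝ (Fin d))).contDiff.comp (contDiff_wJac p)

end Network

/-! ### Gradient and Hessian of a quadratic risk -/

section QuadraticRisk

variable {L d n : ℕ} {X : Matrix (Fin n) (Fin d) ℝ} {y : EuclideanSpace ℝ (Fin n)}
  {p w : EuclideanSpace ℝ (Fin d)} {A : Matrix (Fin d) (Fin d) ℝ} {c : ℝ}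

/-- The excess risk of a regressor, a quadratic form in its distance to the optimum `w`. -/
def excess (A : Matrix (Fin d) (Fin d) ℝ) (w v : EuclideanSpace ℝ (Fin d)) : ℝ :=
  inner ℝ (v - w) (act A (v - w))

lemma hasGradientAt_netRisk (hA : Aᵀ = A)
    (hrisk : ∀ v, regRisk X y v = c + excess A w v) (V : Param L d) :
    HasGradientAt (netRisk L X y p) (wJacAdj p V ((2 : ℝ) • act A (wProd p V - w))) V := by
  rw [hasGradientAt_iff_hasFDerivAt]
  have he : HasFDerivAt (fun V : Param L d => wProd p V - w) (wJac p V) V :=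
    (hasFDerivAt_wProd p V).sub_const w
  have h := (he.inner ℝ ((actLM A).hasFDerivAt.comp V he)).const_add c
  have hf : netRisk L X y p = fun V => c + inner ℝ (wProd p V - w) (actLM A (wProd p V - w)) := by
    funext V
    rw [netRisk, hrisk]
    rfl
  rw [hf]
  refine h.congr_fderiv ?_
  ext1 δ
  rw [InnerProductSpace.toDual_apply_apply, inner_wJacAdj]
  simp only [Function.comp_apply, ContinuousLinearMap.comp_apply, fderivInnerCLM_apply,
    ContinuousLinearMap.prod_apply, actLM_apply]
  rw [inner_act, hA, inner_smul_left, real_inner_comm _ (wJac p V δ)]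
  simp
  ring

lemma gradient_netRisk (hA : Aᵀ = A) (hrisk : ∀ v, regRisk X y v = c + excess A w v) :
    gradient (netRisk L X y p)
      = fun V => wJacAdjLM p V ((2 : ℝ) • act A (wProd p V - w)) := by
  funext V
  rw [wJacAdjLM_apply]
  exact (hasGradientAt_netRisk hA hrisk V).gradient

lemma contDiff_gradient_netRisk (hA : Aᵀ = A)
    (hrisk : ∀ v, regRisk X y v = c + excess A w v) :
    ContDiff ℝ 1 (gradient (netRisk L X y p)) := by
  rw [gradient_netRisk hA hrisk]
  refine (contDiff_wJacAdjLM p).clm_apply (ContDiff.const_smul _ ?_)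
  exact (actLM A).contDiff.comp ((contDiff_wProd p).sub contDiff_const)

/-- The Hessian at a global minimizer. -/
lemma netHessian_eq (hA : Aᵀ = A) (hrisk : ∀ v, regRisk X y v = c + excess A w v)
    {W : Param L d} (hW : wProd p W = w) (δ : Param L d) :
    netHessian L X y p W δ = (2 : ℝ) • wJacAdj p W (act A (wJac p W δ)) := by
  have hg : HasFDerivAt (fun V : Param L d => (2 : ℝ) • act A (wProd p V - w))
      ((2 : ℝ) • (actLM A).comp (wJac p W)) W :=
    ((actLM A).hasFDerivAt.comp W ((hasFDerivAt_wProd p W).sub_const w)).const_smul (2 : ℝ)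
  have hc := (((contDiff_wJacAdjLM p).differentiable one_ne_zero) W).hasFDerivAt
  have h := hc.clm_apply hg
  rw [netHessian, gradient_netRisk hA hrisk, h.fderiv]
  -- The term that differentiates the Jacobian is applied to the residual, which vanishes at a
  -- minimizer; only the Gauss-Newton term survives.
  have h0 : act A (wProd p W - w) = 0 := by simp [hW, act]
  simp only [h0, smul_zero, map_zero, add_zero, ContinuousLinearMap.comp_apply,
    smul_apply, map_smul, wJacAdjLM_apply, actLM_apply]

end QuadraticRisk

/-! ### Extreme eigenvalues and Rayleigh quotients -/

section Eigenvalues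

open Module.End

variable {E : Type*} [NormedAddCommGroup E] [InnerProductSpace ℝ E] {T : E →ₗ[ℝ] E}

lemma HasEigenvalue.exists_inner_eq {μ : ℝ} (h : HasEigenvalue T μ) :
    ∃ v : E, v ≠ 0 ∧ inner ℝ (T v) v = μ * ‖v‖ ^ 2 := by
  obtain ⟨v, hv⟩ := h.exists_hasEigenvector
  refine ⟨v, hv.2, ?_⟩
  rw [hv.apply_eq_smul, inner_smul_left, real_inner_self_eq_norm_sq]
  rfl

/-- Nonnegativity of `c` covers an empty set of eigenvalues, whose `sSup` is `0`. -/
lemma sSup_eigenvalues_le {c : ℝ} (hc : 0 ≤ c) (h : ∀ v : E, inner ℝ (T v) v ≤ c * ‖v‖ ^ 2) :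
    sSup {μ : ℝ | HasEigenvalue T μ} ≤ c := by
  refine Real.sSup_le (fun μ hμ => ?_) hc
  obtain ⟨v, hv, hvμ⟩ := HasEigenvalue.exists_inner_eq hμ
  have hpos : 0 < ‖v‖ ^ 2 := by positivity
  exact le_of_mul_le_mul_right (hvμ ▸ h v) hpos

variable [FiniteDimensional ℝ E]

lemma abs_rayleigh_le (T : E →ₗ[ℝ] E) : ∃ C : ℝ, ∀ v : E, |inner ℝ (T v) v / ‖v‖ ^ 2| ≤ C := by
  refine ⟨‖LinearMap.toContinuousLinearMap T‖, fun v => ?_⟩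
  rcases eq_or_ne v 0 with rfl | hv
  · simp
  have hpos : 0 < ‖v‖ ^ 2 := by positivity
  rw [abs_div, abs_of_pos hpos, div_le_iff₀ hpos]
  have h1 := (LinearMap.toContinuousLinearMap T).le_opNorm v
  have h2 := abs_real_inner_le_norm (T v) v
  rw [LinearMap.coe_toContinuousLinearMap'] at h1
  nlinarith [norm_nonneg v]

lemma rayleigh_le_sSup_eigenvalues (hT : T.IsSymmetric) (v : E) :
    inner ℝ (T v) v ≤ sSup {μ : ℝ | HasEigenvalue T μ} * ‖v‖ ^ 2 := by
  rcases eq_or_ne v 0 with rfl | hv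
  · simp
  have : Nontrivial E := ⟨v, 0, hv⟩
  have heig := hT.hasEigenvalue_iSup_of_finiteDimensional
  have hle := le_csSup (finite_hasEigenvalue T).bddAbove heig
  obtain ⟨C, hC⟩ := abs_rayleigh_le T
  have hbdd : BddAbove (Set.range fun x : { x : E // x ≠ 0 } =>
      (RCLike.re (inner ℝ (T x) (x : E)) / ‖(x : E)‖ ^ 2 : ℝ)) := by
    refine ⟨C, ?_⟩
    rintro _ ⟨x, rfl⟩
    exact (le_abs_self _).trans (hC x)
  have hv' := le_ciSup hbdd ⟨v, hv⟩
  have hpos : 0 < ‖v‖ ^ 2 := by positivity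
  rw [← div_le_iff₀ hpos]
  exact hv'.trans hle

lemma exists_hasEigenvalue_le_rayleigh [Nontrivial E] (hT : T.IsSymmetric) :
    ∃ μ, HasEigenvalue T μ ∧ ∀ v : E, μ * ‖v‖ ^ 2 ≤ inner ℝ (T v) v := by
  refine ⟨_, hT.hasEigenvalue_iInf_of_finiteDimensional, fun v => ?_⟩
  rcases eq_or_ne v 0 with rfl | hv
  · simp
  obtain ⟨C, hC⟩ := abs_rayleigh_le T
  have hbdd : BddBelow (Set.range fun x : { x : E // x ≠ 0 } =>
      (RCLike.re (inner ℝ (T x) (x : E)) / ‖(x : E)‖ ^ 2 : ℝ)) := by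
    refine ⟨-C, ?_⟩
    rintro _ ⟨x, rfl⟩
    exact (abs_le.1 (hC x)).1
  have hpos : 0 < ‖v‖ ^ 2 := by positivity
  rw [← le_div_iff₀ hpos]
  exact ciInf_le hbdd ⟨v, hv⟩

end Eigenvalues

/-! ### The empirical covariance and the excess risk -/

section Covariance

open Module.End

variable {n d : ℕ} {X : Matrix (Fin n) (Fin d) ℝ} {y : EuclideanSpace ℝ (Fin n)}

/-- Moves the spectrum from plain functions to Euclidean space, where the theory of symmetric
operators applies. -/
lemma hasEigenvalue_toLin'_iff (A : Matrix (Fin d) (Fin d) ℝ) (μ : ℝ) :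
    HasEigenvalue (Matrix.toLin' A) μ ↔
      HasEigenvalue (actLM A : EuclideanSpace ℝ (Fin d) →ₗ[ℝ] EuclideanSpace ℝ (Fin d)) μ := by
  constructor
  · intro h
    obtain ⟨v, hv⟩ := h.exists_hasEigenvector
    refine hasEigenvalue_of_hasEigenvector (x := WithLp.toLp 2 v) ?_
    refine hasEigenvector_iff.2 ⟨mem_eigenspace_iff.2 ?_, ?_⟩
    · have := hv.apply_eq_smul
      rw [Matrix.toLin'_apply] at this
      simp [act, this]
    · simpa using hv.2
  · intro h
    obtain ⟨v, hv⟩ := h.exists_hasEigenvector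
    refine hasEigenvalue_of_hasEigenvector (x := v.ofLp) ?_
    refine hasEigenvector_iff.2 ⟨mem_eigenspace_iff.2 ?_, ?_⟩
    · have := congrArg WithLp.ofLp hv.apply_eq_smul
      simpa [act] using this
    · simpa using hv.2

lemma empCov_transpose (X : Matrix (Fin n) (Fin d) ℝ) : (empCov X)ᵀ = empCov X := by
  simp [empCov, Matrix.transpose_smul, Matrix.transpose_mul]

lemma isSymmetric_actLM {A : Matrix (Fin d) (Fin d) ℝ} (hA : Aᵀ = A) :
    (actLM A : EuclideanSpace ℝ (Fin d) →ₗ[ℝ] EuclideanSpace ℝ (Fin d)).IsSymmetric := by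
  intro x y
  have := inner_act A x y
  rw [hA] at this
  exact this.symm

lemma inner_empCov (X : Matrix (Fin n) (Fin d) ℝ) (h : EuclideanSpace ℝ (Fin d)) :
    inner ℝ h (act (empCov X) h) = 1 / (n : ℝ) * ‖WithLp.toLp 2 (X *ᵥ h.ofLp)‖ ^ 2 := by
  rw [← real_inner_self_eq_norm_sq]
  simp only [EuclideanSpace.inner_eq_star_dotProduct, star_trivial, act, empCov,
    Matrix.smul_mulVec, smul_dotProduct, smul_eq_mul]
  congr 1
  rw [← Matrix.mulVec_mulVec, Matrix.mulVec_transpose, ← Matrix.dotProduct_mulVec]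

/-- Full rank makes the covariance injective, so every eigenvalue is positive and the restriction to
nonzero eigenvalues is void. The two constants are then the extrema of the Rayleigh quotient. -/
lemma empCov_bounds (hd : 0 < d) (hrank : (empCov X).rank = d) :
    0 < covMinEig X ∧ covMinEig X ≤ covMaxEig X ∧
      ∀ v, covMinEig X * ‖v‖ ^ 2 ≤ inner ℝ v (act (empCov X) v) ∧
        inner ℝ v (act (empCov X) v) ≤ covMaxEig X * ‖v‖ ^ 2 := by
  set T : EuclideanSpace ℝ (Fin d) →ₗ[ℝ] EuclideanSpace ℝ (Fin d) :=
    (actLM (empCov X)).toLinearMap with hTdef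
  have : Nonempty (Fin d) := ⟨⟨0, hd⟩⟩
  have hT : T.IsSymmetric := isSymmetric_actLM (empCov_transpose X)
  have hinner : ∀ v, inner ℝ (T v) v = inner ℝ v (act (empCov X) v) := fun v =>
    real_inner_comm _ _
  have hinj : ∀ v : Fin d → ℝ, empCov X *ᵥ v = 0 → v = 0 := by
    have hr : LinearMap.range (empCov X).mulVecLin = ⊤ :=
      Submodule.eq_top_of_finrank_eq (by rw [← Matrix.rank, hrank]; simp)
    have hk := LinearMap.ker_eq_bot_iff_range_eq_top.2 hr
    intro v hv
    have : v ∈ LinearMap.ker (empCov X).mulVecLin := hv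
    simpa [hk] using this
  have hpos : ∀ μ, HasEigenvalue T μ → 0 < μ := by
    intro μ hμ
    obtain ⟨v, hv, hvμ⟩ := HasEigenvalue.exists_inner_eq hμ
    have hv2 : 0 < ‖v‖ ^ 2 := by positivity
    have hnn : 0 ≤ μ * ‖v‖ ^ 2 := by
      rw [← hvμ, hinner, inner_empCov]
      positivity
    have hμ0 : 0 ≤ μ := nonneg_of_mul_nonneg_left hnn hv2
    refine hμ0.lt_of_ne' ?_
    rintro rfl
    obtain ⟨u, hu⟩ := hμ.exists_hasEigenvector
    have h1 := congrArg WithLp.ofLp hu.apply_eq_smul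
    refine hu.2 ?_
    have := hinj u.ofLp (by simpa [hTdef, act] using h1)
    simpa using this
  have hmax : covMaxEig X = sSup {μ : ℝ | HasEigenvalue T μ} := by
    unfold covMaxEig
    simp_rw [hasEigenvalue_toLin'_iff]
    rfl
  have hmin : covMinEig X = sInf {μ : ℝ | HasEigenvalue T μ} := by
    unfold covMinEig
    simp_rw [hasEigenvalue_toLin'_iff]
    congr 1
    ext μ
    exact ⟨fun h => h.1, fun h => ⟨h, (hpos μ h).ne'⟩⟩
  obtain ⟨m, hm, hmv⟩ := exists_hasEigenvalue_le_rayleigh hT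
  have hne : {μ : ℝ | HasEigenvalue T μ}.Nonempty := ⟨m, hm⟩
  have hfin := (finite_hasEigenvalue T)
  have hmem : covMinEig X ∈ {μ : ℝ | HasEigenvalue T μ} := hmin ▸ hne.csInf_mem hfin
  refine ⟨hpos _ hmem, hmax ▸ le_csSup hfin.bddAbove hmem, fun v => ⟨?_, ?_⟩⟩
  · rw [← hinner]
    refine le_trans ?_ (hmv v)
    gcongr
    exact hmin ▸ csInf_le hfin.bddBelow hm
  · rw [← hinner, hmax]
    exact rayleigh_le_sSup_eigenvalues hT v

/-- The risk is quadratic, and minimality of `w` makes the residual orthogonal to the range of `X`,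
which removes the cross term. -/
lemma regRisk_eq_add_excess {w : EuclideanSpace ℝ (Fin d)}
    (hw : IsMinOn (regRisk X y) Set.univ w) (v : EuclideanSpace ℝ (Fin d)) :
    regRisk X y v = regRisk X y w + excess (empCov X) w v := by
  -- For `n = 0` the convention `1 / 0 = 0` makes both risks and the excess vanish.
  rcases Nat.eq_zero_or_pos n with rfl | hn
  · simp [regRisk, excess, inner_empCov]
  have hn' : (0 : ℝ) < n := by exact_mod_cast hn
  set r : EuclideanSpace ℝ (Fin n) := y - WithLp.toLp 2 (X *ᵥ w.ofLp) with hr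
  let M : EuclideanSpace ℝ (Fin d) → EuclideanSpace ℝ (Fin n) := fun h =>
    WithLp.toLp 2 (X *ᵥ h.ofLp)
  have hexp : ∀ h, regRisk X y (w + h)
      = regRisk X y w + 1 / (n : ℝ) * (‖M h‖ ^ 2 - 2 * inner ℝ r (M h)) := by
    intro h
    have : y - WithLp.toLp 2 (X *ᵥ (w + h).ofLp) = r - M h := by
      simp [hr, M, Matrix.mulVec_add, sub_sub]
    rw [regRisk, this, norm_sub_sq_real, regRisk, ← hr]
    ring
  have hMs : ∀ (t : ℝ) h, M (t • h) = t • M h := by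
    intro t h
    simp [M, Matrix.mulVec_smul]
  have horth : ∀ h, inner ℝ r (M h) = 0 := by
    intro h
    have key : ∀ t : ℝ, 0 ≤ t ^ 2 * ‖M h‖ ^ 2 - 2 * t * inner ℝ r (M h) := by
      intro t
      have h1 := isMinOn_univ_iff.1 hw (w + t • h)
      rw [hexp, hMs, norm_smul, inner_smul_right, mul_pow, Real.norm_eq_abs, sq_abs] at h1
      have h2 : 0 ≤ 1 / (n : ℝ) * (t ^ 2 * ‖M h‖ ^ 2 - 2 * (t * inner ℝ r (M h))) := by linarith
      have h3 := nonneg_of_mul_nonneg_right h2 (by positivity)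
      linarith
    by_contra hne
    have hM : M h ≠ 0 := fun h0 => hne (by rw [h0, inner_zero_right])
    have hM2 : 0 < ‖M h‖ ^ 2 := by positivity
    have h1 := key (inner ℝ r (M h) / ‖M h‖ ^ 2)
    have h2 : (inner ℝ r (M h) / ‖M h‖ ^ 2) ^ 2 * ‖M h‖ ^ 2
        - 2 * (inner ℝ r (M h) / ‖M h‖ ^ 2) * inner ℝ r (M h)
        = -(inner ℝ r (M h) ^ 2 / ‖M h‖ ^ 2) := by
      field_simp
      ring
    rw [h2] at h1
    have : 0 < inner ℝ r (M h) ^ 2 / ‖M h‖ ^ 2 := by positivity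
    linarith
  have h := hexp (v - w)
  rw [add_sub_cancel, horth, mul_zero, sub_zero] at h
  rw [h, excess, inner_empCov]

end Covariance

/-! ### A quadratic form against its gradient -/

section QuadraticForm

variable {d : ℕ} {A : Matrix (Fin d) (Fin d) ℝ} {lo up : ℝ}

/-- Comparison of a positive quadratic form with its gradient, from below. -/
lemma quadForm_le_sq_norm_act (hlo : 0 < lo)
    (hl : ∀ v : EuclideanSpace ℝ (Fin d), lo * ‖v‖ ^ 2 ≤ inner ℝ v (act A v))
    (e : EuclideanSpace ℝ (Fin d)) : lo * inner ℝ e (act A e) ≤ ‖act A e‖ ^ 2 := by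
  have h1 := hl e
  have h2 := real_inner_le_norm e (act A e)
  rcases eq_or_ne e 0 with rfl | he
  · simp
  have hpos : 0 < ‖e‖ := norm_pos_iff.2 he
  have h3 : lo * ‖e‖ ≤ ‖act A e‖ := by
    refine le_of_mul_le_mul_right ?_ hpos
    nlinarith
  nlinarith [norm_nonneg (act A e)]

/-- Comparison of a positive quadratic form with its gradient, from above. -/
lemma sq_norm_act_le_quadForm (hA : Aᵀ = A) (hup : 0 < up)
    (hnn : ∀ v : EuclideanSpace ℝ (Fin d), 0 ≤ inner ℝ v (act A v))
    (hu : ∀ v : EuclideanSpace ℝ (Fin d), inner ℝ v (act A v) ≤ up * ‖v‖ ^ 2)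
    (e : EuclideanSpace ℝ (Fin d)) : ‖act A e‖ ^ 2 ≤ up * inner ℝ e (act A e) := by
  set f := act A e with hf
  -- A gradient step of length `1 / up` lowers the form by at least `‖f‖² / up`, and the form stays
  -- nonnegative.
  have h1 := hnn (e - up⁻¹ • f)
  have hlin : act A (e - up⁻¹ • f) = f - up⁻¹ • act A f := by
    simp [act, Matrix.mulVec_sub, Matrix.mulVec_smul, hf]
  have hef : inner ℝ e (act A f) = ‖f‖ ^ 2 := by
    rw [inner_act, hA, real_inner_self_eq_norm_sq]
  rw [hlin, inner_sub_left, inner_sub_right, inner_sub_right, inner_smul_left, inner_smul_right,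
    inner_smul_left, inner_smul_right, hef, real_inner_self_eq_norm_sq] at h1
  simp only [conj_trivial] at h1
  have h2 := hu f
  have h3 : up⁻¹ * (up⁻¹ * inner ℝ f (act A f)) ≤ up⁻¹ * ‖f‖ ^ 2 := by
    gcongr
    rw [inv_mul_le_iff₀ hup]
    exact h2
  have h4 : up⁻¹ * ‖f‖ ^ 2 ≤ inner ℝ e f := by linarith
  rwa [inv_mul_le_iff₀ hup] at h4

end QuadraticForm

/-! ### Bounds for the sharpness of minimizers -/

section Sharpness

variable {L d n : ℕ} {X : Matrix (Fin n) (Fin d) ℝ} {y : EuclideanSpace ℝ (Fin n)}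
  {p w : EuclideanSpace ℝ (Fin d)} {A : Matrix (Fin d) (Fin d) ℝ} {c lo up : ℝ}

lemma inner_netHessian (hA : Aᵀ = A) (hrisk : ∀ v, regRisk X y v = c + excess A w v)
    {W : Param L d} (hW : wProd p W = w) (δ δ' : Param L d) :
    inner ℝ (netHessian L X y p W δ) δ' = 2 * inner ℝ (act A (wJac p W δ)) (wJac p W δ') := by
  rw [netHessian_eq hA hrisk hW, inner_smul_left, inner_wJacAdj]
  simp

lemma isSymmetric_netHessian (hA : Aᵀ = A) (hrisk : ∀ v, regRisk X y v = c + excess A w v)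
    {W : Param L d} (hW : wProd p W = w) :
    (netHessian L X y p W : Param L d →ₗ[ℝ] Param L d).IsSymmetric := by
  intro δ δ'
  change inner ℝ (netHessian L X y p W δ) δ' = inner ℝ δ (netHessian L X y p W δ')
  rw [real_inner_comm (netHessian L X y p W δ') δ, inner_netHessian hA hrisk hW,
    inner_netHessian hA hrisk hW, real_inner_comm (wJac p W δ) (act A (wJac p W δ')), inner_act, hA]

lemma sharpness_le (hA : Aᵀ = A) (hrisk : ∀ v, regRisk X y v = c + excess A w v)
    (hup : 0 ≤ up) (hu : ∀ v : EuclideanSpace ℝ (Fin d), inner ℝ v (act A v) ≤ up * ‖v‖ ^ 2)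
    {W : Param L d} (hW : wProd p W = w) {b : ℝ}
    (hJ : ∀ δ, ‖wJac p W δ‖ ^ 2 ≤ b * ‖δ‖ ^ 2) (hb : 0 ≤ b) :
    sharpness L X y p W ≤ 2 * up * b := by
  refine sSup_eigenvalues_le (by positivity) fun δ => ?_
  change inner ℝ (netHessian L X y p W δ) δ ≤ _
  rw [inner_netHessian hA hrisk hW, real_inner_comm]
  have h1 := hu (wJac p W δ)
  have h2 := mul_le_mul_of_nonneg_left (hJ δ) hup
  linarith

/-- The Rayleigh quotient of the Hessian is tested on `δ = J* u`, for which `‖δ‖² = ⟨u, J δ⟩ ≤ ‖u‖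
‖J δ‖`. -/
lemma le_sharpness_of_wJacAdj (hA : Aᵀ = A) (hrisk : ∀ v, regRisk X y v = c + excess A w v)
    (hlo : 0 ≤ lo) (hl : ∀ v : EuclideanSpace ℝ (Fin d), lo * ‖v‖ ^ 2 ≤ inner ℝ v (act A v))
    {W : Param L d} (hW : wProd p W = w) {u : EuclideanSpace ℝ (Fin d)}
    (hu : wJacAdj p W u ≠ 0) :
    2 * lo * ‖wJacAdj p W u‖ ^ 2 ≤ sharpness L X y p W * ‖u‖ ^ 2 := by
  set δ := wJacAdj p W u with hδ
  have h1 := rayleigh_le_sSup_eigenvalues (isSymmetric_netHessian hA hrisk hW) δ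
  change inner ℝ (netHessian L X y p W δ) δ ≤ sharpness L X y p W * ‖δ‖ ^ 2 at h1
  rw [inner_netHessian hA hrisk hW, real_inner_comm] at h1
  have h2 := hl (wJac p W δ)
  have h3 : ‖δ‖ ^ 2 = inner ℝ u (wJac p W δ) := by
    rw [← inner_wJacAdj, ← hδ, real_inner_self_eq_norm_sq]
  have h4 := real_inner_le_norm u (wJac p W δ)
  have hpos : 0 < ‖δ‖ ^ 2 := by positivity
  have h5 : (‖δ‖ ^ 2) ^ 2 ≤ ‖u‖ ^ 2 * ‖wJac p W δ‖ ^ 2 := by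
    rw [← mul_pow]
    exact pow_le_pow_left₀ hpos.le (h3.le.trans h4) 2
  refine le_of_mul_le_mul_right ?_ hpos
  calc 2 * lo * ‖δ‖ ^ 2 * ‖δ‖ ^ 2 = 2 * lo * (‖δ‖ ^ 2) ^ 2 := by ring
    _ ≤ 2 * lo * (‖u‖ ^ 2 * ‖wJac p W δ‖ ^ 2) := by gcongr
    _ = ‖u‖ ^ 2 * (2 * (lo * ‖wJac p W δ‖ ^ 2)) := by ring
    _ ≤ ‖u‖ ^ 2 * (sharpness L X y p W * ‖δ‖ ^ 2) :=
        mul_le_mul_of_nonneg_left (by linarith) (by positivity)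
    _ = _ := by ring

/-- AM-GM in normalized form, from `log x ≤ x - 1`. -/
lemma card_le_sum_of_one_le_prod {ι : Type*} (s : Finset ι) (x : ι → ℝ) (hx : ∀ i ∈ s, 0 < x i)
    (h : 1 ≤ ∏ i ∈ s, x i) : (s.card : ℝ) ≤ ∑ i ∈ s, x i := by
  have h1 : 0 ≤ ∑ i ∈ s, Real.log (x i) := by
    rw [← Real.log_prod fun i hi => (hx i hi).ne']
    exact Real.log_nonneg h
  have h2 : ∑ i ∈ s, Real.log (x i) ≤ ∑ i ∈ s, (x i - 1) :=
    Finset.sum_le_sum fun i hi => Real.log_le_sub_one_of_pos (hx i hi)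
  rw [Finset.sum_sub_distrib, Finset.sum_const, nsmul_eq_mul, mul_one] at h2
  linarith

/-- All global minimizers are sharp: a lower bound for the Jacobian. -/
lemma le_sq_norm_wJacAdj (hL : 0 < L) {W : Param L d} (hw : wProd p W ≠ 0) (hp : p ≠ 0) :
    L * (‖wProd p W‖ ^ 2 * min (‖wProd p W‖ ^ 2) (‖p‖ ^ 2)) ≤ ‖wJacAdj p W (wProd p W)‖ ^ 2 := by
  set w := wProd p W with hwdef
  let q : ℕ → ℝ := fun k => ‖act (tailProd W k) p‖
  have hsplit : ∀ k ≤ L, act (headProd W k) (act (tailProd W k) p) = w := by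
    intro k hk
    rw [← act_mul, headProd_mul_tailProd W hk, hwdef, wProd_eq_act_headProd]
  have hq : ∀ k ≤ L, 0 < q k := by
    intro k hk
    refine norm_pos_iff.2 fun h0 => hw ?_
    rw [← hsplit k hk, h0]
    simp [act]
  have hq0 : q 0 = ‖w‖ := by
    have := hsplit 0 (Nat.zero_le _)
    simp only [headProd, runProd_zero] at this
    rw [← this]
    simp [q, act]
  have hqL : q L = ‖p‖ := by simp [q, tailProd_self, act]
  have hwpos : 0 < ‖w‖ := norm_pos_iff.2 hw
  have hppos : 0 < ‖p‖ := norm_pos_iff.2 hp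
  -- Cauchy-Schwarz on the splitting at layer `k` bounds the head factor below by `‖w‖² / q k`. The
  -- ratios `q (k + 1) / q k` that appear telescope.
  have hterm : ∀ k < L, ‖w‖ ^ 4 * (q (k + 1) / q k) ^ 2
      ≤ (‖act (headProd W k)ᵀ w‖ * q (k + 1)) ^ 2 := by
    intro k hk
    have h1 : ‖w‖ ^ 2 ≤ ‖act (headProd W k)ᵀ w‖ * q k := by
      calc ‖w‖ ^ 2 = inner ℝ w (act (headProd W k) (act (tailProd W k) p)) := by
            rw [hsplit k hk.le, real_inner_self_eq_norm_sq]
        _ ≤ _ := by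
            rw [inner_act]
            exact real_inner_le_norm _ _
    have hqk := hq k hk.le
    have h2 : ‖w‖ ^ 2 / q k ≤ ‖act (headProd W k)ᵀ w‖ := by rwa [div_le_iff₀ hqk]
    calc ‖w‖ ^ 4 * (q (k + 1) / q k) ^ 2 = (‖w‖ ^ 2 / q k * q (k + 1)) ^ 2 := by ring
      _ ≤ _ := by
        have := hq (k + 1) hk
        gcongr
  have hsum : ‖w‖ ^ 4 * ∑ k ∈ Finset.range L, (q (k + 1) / q k) ^ 2 ≤ ‖wJacAdj p W w‖ ^ 2 := by
    rw [sq_norm_wJacAdj, Finset.mul_sum, Finset.sum_range]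
    exact Finset.sum_le_sum fun k _ => hterm k k.2
  have hprod : ∀ m ≤ L, ∏ k ∈ Finset.range m, (q (k + 1) / q k) ^ 2 = (q m / q 0) ^ 2 := by
    intro m hm
    induction m with
    | zero =>
      have := hq 0 hm
      simp [div_self this.ne']
    | succ m ih =>
      have h0 := hq 0 (Nat.zero_le _)
      have h1 := hq m (by omega)
      rw [Finset.prod_range_succ, ih (by omega)]
      field_simp
  -- Since `c ≤ 1` and `L ≥ 1`, `c ^ L ≤ c ≤ (‖p‖ / ‖w‖)²`: the squared ratios divided by `c` have
  -- product at least `1`, and no `L`-th root is needed.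
  set c := min 1 ((‖p‖ / ‖w‖) ^ 2) with hc
  have hc0 : 0 < c := lt_min one_pos (by positivity)
  have hc1 : c ≤ 1 := min_le_left _ _
  have hamgm : (L : ℝ) * c ≤ ∑ k ∈ Finset.range L, (q (k + 1) / q k) ^ 2 := by
    have h := card_le_sum_of_one_le_prod (Finset.range L) (fun k => (q (k + 1) / q k) ^ 2 / c)
      (fun k hk => by
        have := hq k (Finset.mem_range.1 hk).le
        have := hq (k + 1) (Finset.mem_range.1 hk)
        positivity)
      (by
        rw [Finset.prod_div_distrib, hprod L le_rfl, hq0, hqL, Finset.prod_const,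
          Finset.card_range, le_div_iff₀ (by positivity), one_mul]
        exact (pow_le_of_le_one hc0.le hc1 hL.ne').trans (min_le_right _ _))
    rw [Finset.card_range, ← Finset.sum_div, le_div_iff₀ hc0] at h
    exact h
  have hmin : ‖w‖ ^ 2 * min (‖w‖ ^ 2) (‖p‖ ^ 2) = ‖w‖ ^ 4 * c := by
    rw [hc, mul_min_of_nonneg _ _ (by positivity), mul_min_of_nonneg _ _ (by positivity)]
    congr 1
    · ring
    · field_simp
  calc (L : ℝ) * (‖w‖ ^ 2 * min (‖w‖ ^ 2) (‖p‖ ^ 2)) = ‖w‖ ^ 4 * (L * c) := by rw [hmin]; ring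
    _ ≤ _ := (mul_le_mul_of_nonneg_left hamgm (by positivity)).trans hsum

/-- The test vector is `u = w` itself; the factor `‖w‖²` in its Jacobian bound cancels the norm of
`u`. -/
lemma le_sharpness (hL : 0 < L) (hA : Aᵀ = A)
    (hrisk : ∀ v, regRisk X y v = c + excess A w v)
    (hlo : 0 ≤ lo) (hl : ∀ v : EuclideanSpace ℝ (Fin d), lo * ‖v‖ ^ 2 ≤ inner ℝ v (act A v))
    {W : Param L d} (hW : wProd p W = w) (hw : w ≠ 0) (hp : p ≠ 0) :
    2 * lo * (L * min (‖w‖ ^ 2) (‖p‖ ^ 2)) ≤ sharpness L X y p W := by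
  have h1 := le_sq_norm_wJacAdj hL (hW.symm ▸ hw) hp
  rw [hW] at h1
  have hwpos : 0 < ‖w‖ := norm_pos_iff.2 hw
  have hppos : 0 < ‖p‖ := norm_pos_iff.2 hp
  have hL' : (0 : ℝ) < L := by exact_mod_cast hL
  have hmin : 0 < min (‖w‖ ^ 2) (‖p‖ ^ 2) := lt_min (by positivity) (by positivity)
  have hJ : wJacAdj p W w ≠ 0 := by
    intro h0
    rw [h0, norm_zero] at h1
    have : 0 < L * (‖w‖ ^ 2 * min (‖w‖ ^ 2) (‖p‖ ^ 2)) := by positivity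
    norm_num at h1
    linarith
  have h2 := le_sharpness_of_wJacAdj hA hrisk hlo hl hW hJ
  refine le_of_mul_le_mul_right ?_ (by positivity : 0 < ‖w‖ ^ 2)
  calc 2 * lo * (L * min (‖w‖ ^ 2) (‖p‖ ^ 2)) * ‖w‖ ^ 2
      = 2 * lo * (L * (‖w‖ ^ 2 * min (‖w‖ ^ 2) (‖p‖ ^ 2))) := by ring
    _ ≤ 2 * lo * ‖wJacAdj p W w‖ ^ 2 := by gcongr
    _ ≤ _ := h2

end Sharpness

/-! ### Global solutions of differential equations -/

section GlobalSolutions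

open Set Filter Topology

variable {E : Type*} [NormedAddCommGroup E] [NormedSpace ℝ E]

/-- A bounded Lipschitz vector field has solutions on every interval `[0, n]`. -/
lemma exists_solution_Icc [CompleteSpace E] {F : E → E} {K M : NNReal} (hF : LipschitzWith K F)
    (hM : ∀ x, ‖F x‖ ≤ M) (x₀ : E) (n : ℕ) :
    ∃ α : ℝ → E, α 0 = x₀ ∧
      ∀ t ∈ Icc (0 : ℝ) n, HasDerivWithinAt α (F (α t)) (Icc (0 : ℝ) n) t := by
  -- Speed at most `M` keeps the solution within `M * n` up to time `n`, so one application covers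
  -- the whole interval.
  have h : IsPicardLindelof (fun _ => F) (tmin := 0) (tmax := n)
      ⟨0, left_mem_Icc.2 (Nat.cast_nonneg n)⟩ x₀ (M * n) 0 M K :=
    { lipschitzOnWith := fun _ _ => hF.lipschitzOnWith
      continuousOn := fun _ _ => continuousOn_const
      norm_le := fun _ _ x _ => hM x
      mul_max_le := by simp }
  exact h.exists_eq_forall_mem_Icc_hasDerivWithinAt₀

/-- A bounded Lipschitz vector field has global solutions. -/
lemma exists_solution_Ici [CompleteSpace E] {F : E → E} {K M : NNReal} (hF : LipschitzWith K F)
    (hM : ∀ x, ‖F x‖ ≤ M) (x₀ : E) :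
    ∃ α : ℝ → E, α 0 = x₀ ∧ ∀ t, 0 ≤ t → HasDerivWithinAt α (F (α t)) (Ici 0) t := by
  choose β hβ0 hβ using exists_solution_Icc hF hM x₀
  have hright : ∀ n : ℕ, ∀ t ∈ Ico (0 : ℝ) n, HasDerivWithinAt (β n) (F (β n t)) (Ici t) t := by
    intro n t ht
    exact ((hβ n t ⟨ht.1, ht.2.le⟩).mono (Icc_subset_Icc_left ht.1)).mono_of_mem_nhdsWithin
      (Icc_mem_nhdsGE ht.2)
  have hcons : ∀ m n : ℕ, m ≤ n → ∀ t ∈ Icc (0 : ℝ) m, β m t = β n t := by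
    intro m n hmn
    have hmn' : (m : ℝ) ≤ n := by exact_mod_cast hmn
    refine ODE_solution_unique (v := fun _ => F) (fun _ => hF)
      (HasDerivWithinAt.continuousOn (hβ m)) (hright m)
      ((HasDerivWithinAt.continuousOn (hβ n)).mono (Icc_subset_Icc_right hmn'))
      (fun t ht => hright n t ⟨ht.1, ht.2.trans_le hmn'⟩) ((hβ0 m).trans (hβ0 n).symm)
  let α : ℝ → E := fun t => β (⌊t⌋₊ + 1) t
  have hα : ∀ (n : ℕ) (t : ℝ), 0 ≤ t → t < n → α t = β n t := by
    intro n t ht htn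
    refine hcons _ n (Nat.succ_le_of_lt ((Nat.floor_lt ht).2 htn)) t ⟨ht, ?_⟩
    push_cast
    exact (Nat.lt_floor_add_one t).le
  refine ⟨α, ?_, fun t ht => ?_⟩
  · rw [hα 1 0 le_rfl (by norm_num), hβ0]
  · have htn : t < ((⌊t⌋₊ + 1 : ℕ) : ℝ) := by
      push_cast
      exact Nat.lt_floor_add_one t
    have h1 := hβ (⌊t⌋₊ + 1) t ⟨ht, htn.le⟩
    have hmem : Icc (0 : ℝ) ((⌊t⌋₊ + 1 : ℕ) : ℝ) ∈ 𝓝[Ici 0] t := by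
      rw [← Ici_inter_Iic]
      exact inter_mem self_mem_nhdsWithin (mem_nhdsWithin_of_mem_nhds (Iic_mem_nhds htn))
    have h2 := h1.mono_of_mem_nhdsWithin hmem
    have heq : α =ᶠ[𝓝[Ici 0] t] β (⌊t⌋₊ + 1) := by
      filter_upwards [self_mem_nhdsWithin, mem_nhdsWithin_of_mem_nhds (Iio_mem_nhds htn)]
        with s hs1 hs2
      exact hα _ s hs1 hs2
    have h3 := h2.congr_of_eventuallyEq heq (hα _ t ht htn)
    rwa [← hα _ t ht htn] at h3

/-- A `C¹` vector field, cut off outside of a ball, has global solutions. -/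
lemma exists_solution_of_contDiff [FiniteDimensional ℝ E] {F : E → E} (hF : ContDiff ℝ 1 F)
    (x₀ : E) {R : ℝ} (hR : 0 < R) :
    ∃ α : ℝ → E, α 0 = x₀ ∧ ContinuousOn α (Ici 0) ∧ ∀ t, 0 ≤ t →
      α t ∈ Metric.closedBall x₀ R → HasDerivWithinAt α (F (α t)) (Ici 0) t := by
  have : CompleteSpace E := FiniteDimensional.complete ℝ E
  let χ : ContDiffBump x₀ := ⟨R, R + 1, hR, by linarith⟩
  have hG : ContDiff ℝ 1 fun x => χ x • F x := χ.contDiff.smul hF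
  have hsupp : HasCompactSupport fun x => χ x • F x := χ.hasCompactSupport.smul_right
  obtain ⟨K, hK⟩ := hG.lipschitzWith_of_hasCompactSupport hsupp one_ne_zero
  obtain ⟨C, hC⟩ := hsupp.exists_bound_of_continuous hG.continuous
  obtain ⟨α, h0, hα⟩ := exists_solution_Ici hK (M := C.toNNReal)
    (fun x => (hC x).trans (Real.le_coe_toNNReal C)) x₀
  refine ⟨α, h0, HasDerivWithinAt.continuousOn hα, fun t ht hmem => ?_⟩
  have h := hα t ht
  rwa [χ.one_of_mem_closedBall hmem, one_smul] at h

end GlobalSolutions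

/-! ### Gradient flows trapped by a Polyak-Łojasiewicz inequality -/

section Trap

open Set Filter Topology

variable {E F κ : Type*} [NormedAddCommGroup E] [InnerProductSpace ℝ E]
  [NormedAddCommGroup F] [NormedSpace ℝ F]

/-- The parameters all of whose blocks are close to those of `x₀`. -/
def trapRegion (π : κ → E →L[ℝ] F) (x₀ : E) (ρ : ℝ) : Set E :=
  {V | ∀ k, ‖π k (V - x₀)‖ ≤ ρ}

lemma isClosed_trapRegion (π : κ → E →L[ℝ] F) (x₀ : E) (ρ : ℝ) : IsClosed (trapRegion π x₀ ρ) := by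
  simp only [trapRegion, ofPred_forall]
  exact isClosed_iInter fun k => isClosed_le (by fun_prop) continuous_const

variable [CompleteSpace E]

/-- A Polyak-Łojasiewicz inequality near `x₀`, with bounds for the blocks of the gradient that
keep a gradient flow from `x₀` in the region. -/
structure GradientTrap (f : E → ℝ) (g : E → E) (π : κ → E →L[ℝ] F) (x₀ : E)
    (ρ μ b C : ℝ) : Prop where
  hasGradientAt : ∀ V, HasGradientAt f (g V) V
  nonneg : ∀ V, 0 ≤ f V
  pl : ∀ V ∈ trapRegion π x₀ ρ, μ * f V ≤ ‖g V‖ ^ 2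
  block_le : ∀ V ∈ trapRegion π x₀ ρ, ∀ k, ‖π k (g V)‖ ≤ b * √(f V)
  norm_le : ∀ V ∈ trapRegion π x₀ ρ, ‖g V‖ ≤ C * √(f V)
  small : b * √(f x₀) * (2 / μ) < ρ
  mu_pos : 0 < μ
  b_nonneg : 0 ≤ b
  C_nonneg : 0 ≤ C

variable {f : E → ℝ} {g : E → E} {π : κ → E →L[ℝ] F} {x₀ : E} {ρ μ b C : ℝ} {W : ℝ → E}

lemma hasDerivAt_exp_decay (a : ℝ) (hμ : 0 < μ) (t : ℝ) :
    HasDerivAt (fun t => -(a * (2 / μ)) * Real.exp (-(μ / 2) * t))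
      (a * Real.exp (-(μ / 2) * t)) t := by
  have h := (((hasDerivAt_id t).const_mul (-(μ / 2))).exp).const_mul (-(a * (2 / μ)))
  refine h.congr_deriv ?_
  simp only [id]
  field_simp

namespace GradientTrap

/-- The function `exp (μ t) f (W t)` is nonincreasing: its derivative is `exp (μ t) (μ f - ‖g‖²)`,
nonpositive by the Polyak-Łojasiewicz inequality. -/
lemma decay (H : GradientTrap f g π x₀ ρ μ b C) (h0 : W 0 = x₀)
    (hc : ContinuousOn W (Ici 0))
    (hW : ∀ t, 0 ≤ t → W t ∈ trapRegion π x₀ ρ → HasDerivWithinAt W (-g (W t)) (Ici 0) t)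
    {T : ℝ} (hT : ∀ s ∈ Ico 0 T, W s ∈ trapRegion π x₀ ρ) :
    ∀ t ∈ Icc 0 T, f (W t) ≤ f x₀ * Real.exp (-μ * t) := by
  have hfc : Continuous f :=
    continuous_iff_continuousAt.2 fun V => (H.hasGradientAt V).hasFDerivAt.continuousAt
  have key := image_le_of_deriv_right_le_deriv_boundary (a := 0) (b := T)
    (f := fun t => Real.exp (μ * t) * f (W t)) (B := fun _ => f x₀) (B' := fun _ => 0)
    (f' := fun t => Real.exp (μ * t) * (μ * f (W t) - ‖g (W t)‖ ^ 2))
    ?_ ?_ ?_ continuousOn_const (fun t _ => hasDerivWithinAt_const _ _ _) ?_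
  · intro t ht
    have := key ht
    rw [neg_mul, Real.exp_neg, ← div_eq_mul_inv, le_div_iff₀ (Real.exp_pos _), mul_comm]
    exact this
  · exact (Continuous.continuousOn (by fun_prop)).mul
      (hfc.comp_continuousOn (hc.mono Icc_subset_Ici_self))
  · intro t ht
    have h1 := (hW t ht.1 (hT t ht)).mono (Ici_subset_Ici.2 ht.1)
    have h2 := (H.hasGradientAt (W t)).hasFDerivAt.comp_hasDerivWithinAt t h1
    have h3 : HasDerivWithinAt (fun t => Real.exp (μ * t)) (Real.exp (μ * t) * (μ * 1)) (Ici t) t :=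
      (((hasDerivAt_id t).const_mul μ).exp).hasDerivWithinAt
    refine (h3.mul h2).congr_deriv ?_
    simp only [Function.comp_apply, InnerProductSpace.toDual_apply_apply, inner_neg_right,
      real_inner_self_eq_norm_sq]
    ring
  · simp [h0]
  · intro t ht
    have := H.pl (W t) (hT t ht)
    exact mul_nonpos_of_nonneg_of_nonpos (Real.exp_pos _).le (by linarith)

lemma sqrt_decay (H : GradientTrap f g π x₀ ρ μ b C) {t : ℝ} {V : E}
    (h : f V ≤ f x₀ * Real.exp (-μ * t)) :
    √(f V) ≤ √(f x₀) * Real.exp (-(μ / 2) * t) := by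
  refine (Real.sqrt_le_sqrt h).trans_eq ?_
  have he : Real.exp (-μ * t) = Real.exp (-(μ / 2) * t) ^ 2 := by
    rw [← Real.exp_nat_mul]
    congr 1
    push_cast
    ring
  rw [Real.sqrt_mul (H.nonneg x₀), he, Real.sqrt_sq (Real.exp_pos _).le]

/-- The displacement of a curve with exponentially decaying speed. -/
lemma norm_sub_le_of_decay {G : Type*} [NormedAddCommGroup G] [NormedSpace ℝ G]
    {Z : ℝ → G} {Z' : ℝ → G} {a s T : ℝ} (hμ : 0 < μ) (hc : ContinuousOn Z (Icc s T))
    (hd : ∀ t ∈ Ico s T, HasDerivWithinAt Z (Z' t) (Ici t) t)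
    (hb : ∀ t ∈ Ico s T, ‖Z' t‖ ≤ a * Real.exp (-(μ / 2) * t)) (ha : 0 ≤ a) (hsT : s ≤ T) :
    ‖Z T - Z s‖ ≤ a * (2 / μ) * Real.exp (-(μ / 2) * s) := by
  have key := image_norm_le_of_norm_deriv_right_le_deriv_boundary (a := s) (b := T)
    (f := fun t => Z t - Z s) (f' := Z')
    (B := fun t => a * (2 / μ) * Real.exp (-(μ / 2) * s)
      + -(a * (2 / μ)) * Real.exp (-(μ / 2) * t))
    (B' := fun t => a * Real.exp (-(μ / 2) * t))
    (hc.sub continuousOn_const) (fun t ht => (hd t ht).sub_const _) (by simp)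
    (fun t => (hasDerivAt_exp_decay a hμ t).const_add _) hb ⟨hsT, le_rfl⟩
  have : 0 ≤ a * (2 / μ) * Real.exp (-(μ / 2) * T) := by positivity
  linarith

/-- Continuity argument: a flow that has stayed in the region up to time `t` has moved each block by
at most `b √(f x₀) (2 / μ) < ρ`, so it stays a little longer. The equation is only assumed inside
the region, so that solutions of a cut-off equation qualify. -/
lemma mem_trapRegion [Finite κ] (H : GradientTrap f g π x₀ ρ μ b C) (h0 : W 0 = x₀)
    (hc : ContinuousOn W (Ici 0))
    (hW : ∀ t, 0 ≤ t → W t ∈ trapRegion π x₀ ρ → HasDerivWithinAt W (-g (W t)) (Ici 0) t)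
    {T : ℝ} (hT0 : 0 ≤ T) : W T ∈ trapRegion π x₀ ρ := by
  have hμ := H.mu_pos
  have hb := H.b_nonneg
  have hsub : Icc 0 T ⊆ {t | W t ∈ trapRegion π x₀ ρ} := by
    refine IsClosed.Icc_subset_of_forall_mem_nhdsGT_of_Icc_subset ?_ ?_ ?_
    · rw [inter_comm]
      exact (hc.mono Icc_subset_Ici_self).preimage_isClosed_of_isClosed isClosed_Icc
        (isClosed_trapRegion π x₀ ρ)
    · intro k
      rw [h0, sub_self, map_zero, norm_zero]
      refine le_trans ?_ H.small.le
      positivity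
    · intro t ht hts
      have hlt : ∀ k, ‖π k (W t - x₀)‖ < ρ := by
        intro k
        refine lt_of_le_of_lt ?_ H.small
        have hts' : ∀ s ∈ Ico 0 t, W s ∈ trapRegion π x₀ ρ := fun s hs => hts ⟨hs.1, hs.2.le⟩
        have hdec := H.decay h0 hc hW hts'
        have := norm_sub_le_of_decay (μ := μ) (Z := fun t => π k (W t))
          (Z' := fun t => π k (-g (W t))) (a := b * √(f x₀)) (s := 0) (T := t) hμ
          ((π k).continuous.comp_continuousOn (hc.mono Icc_subset_Ici_self))
          (fun s hs => (π k).hasFDerivAt.comp_hasDerivWithinAt s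
            ((hW s hs.1 (hts' s hs)).mono (Ici_subset_Ici.2 hs.1)))
          (fun s hs => by
            rw [map_neg, norm_neg]
            refine (H.block_le _ (hts' s hs) k).trans ?_
            rw [mul_assoc]
            gcongr
            exact H.sqrt_decay (hdec s ⟨hs.1, hs.2.le⟩)) (by positivity) ht.1
        simpa [h0, map_sub] using this
      have hct : Tendsto W (𝓝[>] t) (𝓝 (W t)) :=
        (hc t ht.1).mono_left (nhdsWithin_mono _ fun s hs => ht.1.trans (le_of_lt hs))
      have hev : ∀ᶠ s in 𝓝[>] t, ∀ k, ‖π k (W s - x₀)‖ < ρ := by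
        rw [eventually_all]
        intro k
        have h1 : Tendsto (fun s => ‖π k (W s - x₀)‖) (𝓝[>] t) (𝓝 ‖π k (W t - x₀)‖) :=
          (((π k).continuous.tendsto _).comp (hct.sub_const x₀)).norm
        exact h1.eventually_lt_const (hlt k)
      filter_upwards [hev] with s hs k using (hs k).le
  exact hsub ⟨hT0, le_rfl⟩

/-- A gradient flow in the region converges to a zero of the objective in the region. -/
lemma exists_tendsto [Finite κ] (H : GradientTrap f g π x₀ ρ μ b C) (h0 : W 0 = x₀)
    (hW : ∀ t, 0 ≤ t → HasDerivWithinAt W (-g (W t)) (Ici 0) t) :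
    ∃ V ∈ trapRegion π x₀ ρ, Tendsto W atTop (𝓝 V) ∧ f V = 0 := by
  have hμ := H.mu_pos
  have hC := H.C_nonneg
  have hc : ContinuousOn W (Ici 0) := HasDerivWithinAt.continuousOn hW
  have hmem : ∀ t, 0 ≤ t → W t ∈ trapRegion π x₀ ρ := fun t ht =>
    H.mem_trapRegion h0 hc (fun t ht _ => hW t ht) ht
  have hdec : ∀ t, 0 ≤ t → f (W t) ≤ f x₀ * Real.exp (-μ * t) := fun t ht =>
    H.decay h0 hc (fun t ht _ => hW t ht) (fun s hs => hmem s hs.1) t ⟨ht, le_rfl⟩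
  have hdist : ∀ s t, 0 ≤ s → s ≤ t →
      ‖W t - W s‖ ≤ C * √(f x₀) * (2 / μ) * Real.exp (-(μ / 2) * s) := by
    intro s t hs hst
    refine norm_sub_le_of_decay (Z' := fun t => -g (W t)) hμ (hc.mono fun u hu => hs.trans hu.1)
      (fun u hu => (hW u (hs.trans hu.1)).mono (Ici_subset_Ici.2 (hs.trans hu.1)))
      (fun u hu => ?_) (by positivity) hst
    rw [norm_neg]
    refine (H.norm_le _ (hmem u (hs.trans hu.1))).trans ?_
    rw [mul_assoc]
    gcongr
    exact H.sqrt_decay (hdec u (hs.trans hu.1))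
  have hmax : Tendsto (fun t : ℝ => max t 0) atTop atTop :=
    tendsto_atTop_mono (fun t => le_max_left t 0) tendsto_id
  have hexp : ∀ a : ℝ, 0 < a → Tendsto (fun t : ℝ => Real.exp (-a * t)) atTop (𝓝 0) := by
    intro a ha
    exact Real.tendsto_exp_atBot.comp ((tendsto_const_mul_atBot_of_neg (by linarith)).2 tendsto_id)
  -- Values at negative times are unconstrained, hence the truncation `max t 0`.
  have hcauchy : CauchySeq fun t : ℝ => W (max t 0) := by
    refine cauchySeq_of_le_tendsto_0'
      (fun t => C * √(f x₀) * (2 / μ) * Real.exp (-(μ / 2) * max t 0)) (fun s t hst => ?_) ?_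
    · rw [dist_comm, dist_eq_norm]
      exact hdist _ _ (le_max_right _ _) (max_le_max_right 0 hst)
    · simpa using ((hexp (μ / 2) (by positivity)).comp hmax).const_mul (C * √(f x₀) * (2 / μ))
  obtain ⟨V, hV⟩ := cauchySeq_tendsto_of_complete hcauchy
  have hWV : Tendsto W atTop (𝓝 V) := by
    refine hV.congr' ?_
    filter_upwards [eventually_ge_atTop 0] with t ht
    rw [max_eq_left ht]
  refine ⟨V, ?_, hWV, ?_⟩
  · exact (isClosed_trapRegion π x₀ ρ).mem_of_tendsto hWV
      ((eventually_ge_atTop 0).mono fun t ht => hmem t ht)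
  · have h1 : Tendsto (fun t => f (W t)) atTop (𝓝 (f V)) :=
      ((H.hasGradientAt V).hasFDerivAt.continuousAt.tendsto).comp hWV
    have h2 : Tendsto (fun t => f x₀ * Real.exp (-μ * t)) atTop (𝓝 0) := by
      simpa using (hexp μ hμ).const_mul (f x₀)
    refine le_antisymm (le_of_tendsto_of_tendsto h1 h2 ?_) (H.nonneg V)
    filter_upwards [eventually_ge_atTop 0] with t ht using hdec t ht

end GradientTrap

end Trap

/-! ### Jacobian bounds at well conditioned parameters -/

section WellConditioned

variable {L d : ℕ}

/-- The `k`-th layer of the parameters, as a vector with the Frobenius norm. -/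
def layerCLM (k : Fin L) : Param L d →L[ℝ] EuclideanSpace ℝ (Fin d × Fin d) :=
  LinearMap.toContinuousLinearMap
    { toFun := fun V => WithLp.toLp 2 fun a => V (k, a.1, a.2)
      map_add' := fun _ _ => rfl
      map_smul' := fun _ _ => rfl }

lemma norm_layerCLM (k : Fin L) (V : Param L d) : ‖layerCLM k V‖ = frobNorm (layer V k) := by
  rw [EuclideanSpace.norm_eq, frobNorm, Fintype.sum_prod_type]
  simp only [Real.norm_eq_abs, sq_abs]
  rfl

lemma sq_norm_eq_sum_layerCLM (V : Param L d) : ‖V‖ ^ 2 = ∑ k, ‖layerCLM k V‖ ^ 2 := by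
  simp_rw [sq_norm_param, norm_layerCLM]

/-- Products of layers are well conditioned near well conditioned parameters. -/
lemma bddUnit_of_mem_trapRegion {W₀ V : Param L d} {K r : ℝ}
    (hM : ∀ k ≤ L, BddUnit K (headProd W₀ k)) (hr0 : 0 ≤ r) (hr : K ^ 2 * r ≤ 1 / 3)
    (hV : V ∈ trapRegion layerCLM W₀ (r / L)) {k : ℕ} (hk : k ≤ L) :
    BddUnit (2 * K ^ 2) (headProd V k) ∧ BddUnit (2 * K ^ 2) (tailProd V k) := by
  let e : ℕ → Matrix (Fin d) (Fin d) ℝ := fun k => layersT V k - layersT W₀ k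
  have he : ∀ k < L, ‖e k‖ ≤ r / L := by
    intro k hk
    have h1 : e k = (layer (V - W₀) ⟨k, hk⟩)ᵀ := by
      simp only [e, layersT, hk, dif_pos]
      rfl
    rw [h1, norm_transpose_matrix]
    refine (norm_le_frobNorm _).trans ?_
    rw [← norm_layerCLM]
    exact hV _
  have hsum : layersT V = fun j => layersT W₀ j + e j := by
    funext j
    simp [e]
  have key := bddUnit_runProd_add (layersT W₀) e norm_one_matrix_le hM he hr0 hr
  constructor
  · have h := key 0 k (by omega)
    simp only [zero_add] at h
    rw [headProd, hsum]
    exact h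
  · rw [tailProd, hsum]
    exact key k (L - k) (by omega)

variable {p u : EuclideanSpace ℝ (Fin d)} {V : Param L d} {κ : ℝ}

lemma sq_norm_wJac_le
    (hV : ∀ k ≤ L, BddUnit κ (headProd V k) ∧ BddUnit κ (tailProd V k)) (δ : Param L d) :
    ‖wJac p V δ‖ ^ 2 ≤ (L * (κ ^ 2 * ‖p‖) ^ 2) * ‖δ‖ ^ 2 := by
  have hκ := (hV 0 (Nat.zero_le _)).1.nonneg
  have h1 : ‖wJac p V δ‖ ≤ κ ^ 2 * ‖p‖ * ∑ k, frobNorm (layer δ k) := by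
    rw [wJac_apply, Finset.mul_sum]
    refine norm_sum_le_of_le _ fun k _ => ?_
    calc ‖act (headProd V k) (act (layer δ k)ᵀ (act (tailProd V (k + 1)) p))‖
        ≤ κ * ‖act (layer δ k)ᵀ (act (tailProd V (k + 1)) p)‖ :=
          (hV k k.2.le).1.norm_act_le _
      _ ≤ κ * (frobNorm (layer δ k) * (κ * ‖p‖)) := by
          have hf : 0 ≤ frobNorm (layer δ k) := Real.sqrt_nonneg _
          gcongr
          refine (norm_act_le _ _).trans ?_
          rw [norm_transpose_matrix]
          gcongr
          · exact norm_le_frobNorm _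
          · exact (hV (k + 1) k.2).2.norm_act_le _
      _ = κ ^ 2 * ‖p‖ * frobNorm (layer δ k) := by ring
  have h2 : (∑ k, frobNorm (layer δ k)) ^ 2 ≤ L * ‖δ‖ ^ 2 := by
    rw [sq_norm_param]
    simpa using sq_sum_le_card_mul_sum_sq (s := Finset.univ) (f := fun k => frobNorm (layer δ k))
  calc ‖wJac p V δ‖ ^ 2 ≤ (κ ^ 2 * ‖p‖ * ∑ k, frobNorm (layer δ k)) ^ 2 := by gcongr
    _ = (κ ^ 2 * ‖p‖) ^ 2 * (∑ k, frobNorm (layer δ k)) ^ 2 := by ring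
    _ ≤ (κ ^ 2 * ‖p‖) ^ 2 * (L * ‖δ‖ ^ 2) := by gcongr
    _ = _ := by ring

lemma norm_layer_wJacAdj_le
    (hV : ∀ k ≤ L, BddUnit κ (headProd V k) ∧ BddUnit κ (tailProd V k)) (k : Fin L) :
    ‖layerCLM k (wJacAdj p V u)‖ ≤ κ ^ 2 * ‖p‖ * ‖u‖ := by
  have hκ := (hV 0 (Nat.zero_le _)).1.nonneg
  rw [norm_layerCLM, frobNorm_layer_wJacAdj]
  calc ‖act (headProd V k)ᵀ u‖ * ‖act (tailProd V (k + 1)) p‖ ≤ (κ * ‖u‖) * (κ * ‖p‖) := by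
        gcongr
        · exact (hV k k.2.le).1.transpose.norm_act_le _
        · exact (hV (k + 1) k.2).2.norm_act_le _
    _ = _ := by ring

lemma sq_norm_wJacAdj_le
    (hV : ∀ k ≤ L, BddUnit κ (headProd V k) ∧ BddUnit κ (tailProd V k)) :
    ‖wJacAdj p V u‖ ^ 2 ≤ L * (κ ^ 2 * ‖p‖ * ‖u‖) ^ 2 := by
  rw [sq_norm_eq_sum_layerCLM]
  refine (Finset.sum_le_sum fun k _ =>
    pow_le_pow_left₀ (norm_nonneg _) (norm_layer_wJacAdj_le hV k) 2).trans ?_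
  simp

/-- Source of the Polyak-Łojasiewicz inequality: by the bounds on the inverses, each of the `L`
layers contributes at least `(‖u‖ ‖p‖)² / κ ^ 4`. -/
lemma le_sq_norm_wJacAdj_of_bddUnit
    (hV : ∀ k ≤ L, BddUnit κ (headProd V k) ∧ BddUnit κ (tailProd V k)) :
    L * (‖u‖ * ‖p‖) ^ 2 ≤ κ ^ 4 * ‖wJacAdj p V u‖ ^ 2 := by
  have hκ := (hV 0 (Nat.zero_le _)).1.nonneg
  rw [sq_norm_wJacAdj, Finset.mul_sum]
  have h1 : ∀ k ∈ (Finset.univ : Finset (Fin L)), (‖u‖ * ‖p‖) ^ 2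
      ≤ κ ^ 4 * (‖act (headProd V k)ᵀ u‖ * ‖act (tailProd V (k + 1)) p‖) ^ 2 := by
    intro k _
    calc (‖u‖ * ‖p‖) ^ 2
        ≤ ((κ * ‖act (headProd V k)ᵀ u‖) * (κ * ‖act (tailProd V (k + 1)) p‖)) ^ 2 := by
          gcongr
          · exact (hV k k.2.le).1.transpose.le_norm_act _
          · exact (hV (k + 1) k.2).2.le_norm_act _
      _ = _ := by ring
  simpa using Finset.sum_le_sum h1

end WellConditioned

/-! ### Convergence of the flow and sharpness of its limit -/

section Convergence

variable {L d n : ℕ} {X : Matrix (Fin n) (Fin d) ℝ} {y : EuclideanSpace ℝ (Fin n)}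
  {p w : EuclideanSpace ℝ (Fin d)} {A : Matrix (Fin d) (Fin d) ℝ} {c lo up κ ρ : ℝ}
  {W₀ : Param L d}

/-- The gradient is `J*` applied to twice `A (w_prod - w)`. The form bounds `lo` and `up` compare `A
(w_prod - w)` with the excess risk, and conditioning controls `J*` from both sides. -/
lemma gradientTrap_netRisk (hL : 0 < L) (hA : Aᵀ = A)
    (hrisk : ∀ v, regRisk X y v = c + excess A w v) (hlo : 0 < lo) (hup : 0 < up)
    (hl : ∀ v : EuclideanSpace ℝ (Fin d), lo * ‖v‖ ^ 2 ≤ inner ℝ v (act A v))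
    (hu : ∀ v : EuclideanSpace ℝ (Fin d), inner ℝ v (act A v) ≤ up * ‖v‖ ^ 2)
    (hp : p ≠ 0) (hκ : 0 < κ)
    (hV : ∀ V ∈ trapRegion layerCLM W₀ ρ, ∀ k ≤ L,
      BddUnit κ (headProd V k) ∧ BddUnit κ (tailProd V k))
    {q : ℝ} (hq : 0 ≤ q) (hρ : κ ^ 6 * q < L * ρ)
    (hinit : netRisk L X y p W₀ - c ≤ q ^ 2 * lo ^ 2 * ‖p‖ ^ 2 / up) :
    GradientTrap (fun V => netRisk L X y p V - c) (gradient (netRisk L X y p)) layerCLM W₀ ρ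
      (4 * L * lo * ‖p‖ ^ 2 / κ ^ 4) (2 * κ ^ 2 * ‖p‖ * √up)
      (√L * (2 * κ ^ 2 * ‖p‖ * √up)) := by
  have hppos : 0 < ‖p‖ := norm_pos_iff.2 hp
  have hL' : (0 : ℝ) < L := by exact_mod_cast hL
  have hnn : ∀ v : EuclideanSpace ℝ (Fin d), 0 ≤ inner ℝ v (act A v) := fun v =>
    le_trans (by positivity) (hl v)
  have hf : ∀ V : Param L d, netRisk L X y p V - c
      = inner ℝ (wProd p V - w) (act A (wProd p V - w)) := by
    intro V
    rw [netRisk, hrisk, excess]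
    ring
  have hg : ∀ V : Param L d, gradient (netRisk L X y p) V
      = wJacAdj p V ((2 : ℝ) • act A (wProd p V - w)) := fun V =>
    (hasGradientAt_netRisk hA hrisk V).gradient
  have hact : ∀ V : Param L d, ‖(2 : ℝ) • act A (wProd p V - w)‖
      ≤ 2 * (√up * √(netRisk L X y p V - c)) := by
    intro V
    rw [norm_smul, Real.norm_ofNat, ← Real.sqrt_mul hup.le, hf]
    gcongr
    exact Real.le_sqrt_of_sq_le (sq_norm_act_le_quadForm hA hup hnn hu _)
  refine ⟨fun V => ?_, fun V => ?_, fun V hVm => ?_, fun V hVm k => ?_, fun V hVm => ?_, ?_, ?_,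
    ?_, ?_⟩
  · rw [hg, hasGradientAt_iff_hasFDerivAt]
    exact (hasGradientAt_netRisk hA hrisk V).hasFDerivAt.sub_const c
  · rw [hf]
    exact hnn _
  · have h1 := le_sq_norm_wJacAdj_of_bddUnit (p := p) (u := (2 : ℝ) • act A (wProd p V - w))
      (hV V hVm)
    rw [← hg, norm_smul, Real.norm_ofNat] at h1
    have h2 := quadForm_le_sq_norm_act hlo hl (wProd p V - w)
    rw [div_mul_eq_mul_div, div_le_iff₀ (by positivity), hf]
    calc 4 * L * lo * ‖p‖ ^ 2 * inner ℝ (wProd p V - w) (act A (wProd p V - w))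
        = 4 * L * ‖p‖ ^ 2 * (lo * inner ℝ (wProd p V - w) (act A (wProd p V - w))) := by ring
      _ ≤ 4 * L * ‖p‖ ^ 2 * ‖act A (wProd p V - w)‖ ^ 2 := by gcongr
      _ = L * (2 * ‖act A (wProd p V - w)‖ * ‖p‖) ^ 2 := by ring
      _ ≤ _ := by linarith
  · rw [hg]
    refine (norm_layer_wJacAdj_le (hV V hVm) k).trans ?_
    calc κ ^ 2 * ‖p‖ * ‖(2 : ℝ) • act A (wProd p V - w)‖
        ≤ κ ^ 2 * ‖p‖ * (2 * (√up * √(netRisk L X y p V - c))) := by gcongr; exact hact V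
      _ = _ := by ring
  · rw [hg]
    refine (pow_le_pow_iff_left₀ (norm_nonneg _) (by positivity) two_ne_zero).1
      ((sq_norm_wJacAdj_le (hV V hVm)).trans ?_)
    calc L * (κ ^ 2 * ‖p‖ * ‖(2 : ℝ) • act A (wProd p V - w)‖) ^ 2
        ≤ L * (κ ^ 2 * ‖p‖ * (2 * (√up * √(netRisk L X y p V - c)))) ^ 2 := by
          gcongr
          exact hact V
      _ = √L ^ 2 * (κ ^ 2 * ‖p‖ * (2 * (√up * √(netRisk L X y p V - c)))) ^ 2 := by
          rw [Real.sq_sqrt hL'.le]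
      _ = _ := by ring
  · have hsq : √up * √(netRisk L X y p W₀ - c) ≤ q * lo * ‖p‖ := by
      rw [← Real.sqrt_mul hup.le]
      refine Real.sqrt_le_iff.2 ⟨by positivity, ?_⟩
      rw [le_div_iff₀ hup] at hinit
      linarith
    -- The displacement budget of one layer is `κ ^ 6 * q / L`: the `L` in the Polyak-Łojasiewicz
    -- constant is what makes it of order `1 / L`.
    calc 2 * κ ^ 2 * ‖p‖ * √up * √(netRisk L X y p W₀ - c) * (2 / (4 * L * lo * ‖p‖ ^ 2 / κ ^ 4))
        = 2 * κ ^ 2 * ‖p‖ * (√up * √(netRisk L X y p W₀ - c))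
          * (2 / (4 * L * lo * ‖p‖ ^ 2 / κ ^ 4)) := by ring
      _ ≤ 2 * κ ^ 2 * ‖p‖ * (q * lo * ‖p‖) * (2 / (4 * L * lo * ‖p‖ ^ 2 / κ ^ 4)) := by gcongr
      _ = κ ^ 6 * q / L := by
          field_simp
          ring
      _ < ρ := by
          rw [div_lt_iff₀ hL']
          linarith
  · positivity
  · positivity
  · positivity

/-- The ratio of the sharpness of a well conditioned minimizer to the least possible one. -/
lemma sharpness_div_minSharpness_bounds (hL : 0 < L) (hA : Aᵀ = A)
    (hrisk : ∀ v, regRisk X y v = c + excess A w v) (hlo : 0 < lo) (hup : 0 < up)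
    (hl : ∀ v : EuclideanSpace ℝ (Fin d), lo * ‖v‖ ^ 2 ≤ inner ℝ v (act A v))
    (hu : ∀ v : EuclideanSpace ℝ (Fin d), inner ℝ v (act A v) ≤ up * ‖v‖ ^ 2)
    (hp : p ≠ 0) (hw : w ≠ 0) (hκ : 1 ≤ κ) {V : Param L d} (hVw : wProd p V = w)
    (hV : ∀ k ≤ L, BddUnit κ (headProd V k) ∧ BddUnit κ (tailProd V k)) :
    IsMinOn (netRisk L X y p) Set.univ V ∧
      1 ≤ sharpness L X y p V / minSharpness L X y p ∧
      sharpness L X y p V / minSharpness L X y p ≤ κ ^ 6 * (up / lo) := by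
  have hppos : 0 < ‖p‖ := norm_pos_iff.2 hp
  have hwpos : 0 < ‖w‖ := norm_pos_iff.2 hw
  have hL' : (0 : ℝ) < L := by exact_mod_cast hL
  have hnet : ∀ U : Param L d, netRisk L X y p U = c + excess A w (wProd p U) := fun U => by
    rw [netRisk, hrisk]
  have hex : ∀ v, lo * ‖v - w‖ ^ 2 ≤ excess A w v := fun v => hl _
  have hV0 : netRisk L X y p V = c := by
    rw [hnet, hVw]
    simp [excess]
  have hmin : IsMinOn (netRisk L X y p) Set.univ V := by
    rw [isMinOn_univ_iff]
    intro U
    rw [hV0, hnet]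
    have := hex (wProd p U)
    have : 0 ≤ lo * ‖wProd p U - w‖ ^ 2 := by positivity
    linarith
  have hminw : ∀ U : Param L d, IsMinOn (netRisk L X y p) Set.univ U → wProd p U = w := by
    intro U hU
    have h1 := isMinOn_univ_iff.1 hU V
    rw [hV0, hnet] at h1
    have h2 := hex (wProd p U)
    by_contra hne
    have : 0 < ‖wProd p U - w‖ := norm_pos_iff.2 (sub_ne_zero.2 hne)
    have : 0 < lo * ‖wProd p U - w‖ ^ 2 := by positivity
    linarith
  have hmem : sharpness L X y p V ∈
      sharpness L X y p '' {W : Param L d | IsMinOn (netRisk L X y p) Set.univ W} := ⟨V, hmin, rfl⟩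
  have hlower : ∀ a ∈ sharpness L X y p '' {W : Param L d | IsMinOn (netRisk L X y p) Set.univ W},
      2 * lo * (L * min (‖w‖ ^ 2) (‖p‖ ^ 2)) ≤ a := by
    rintro _ ⟨U, hU, rfl⟩
    exact le_sharpness hL hA hrisk hlo.le hl (hminw U hU) hw hp
  have hmS : 2 * lo * (L * min (‖w‖ ^ 2) (‖p‖ ^ 2)) ≤ minSharpness L X y p :=
    le_csInf ⟨_, hmem⟩ hlower
  -- Inverting the full product makes the minimum in the lower bound comparable to `‖p‖²`. This
  -- costs `κ ^ 2`, on top of the `κ ^ 4` from the upper bound on the Jacobian.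
  have hpw : ‖p‖ ≤ κ * ‖w‖ := by
    have h := (hV L le_rfl).1.le_norm_act p
    rwa [← wProd_eq_act_headProd, hVw] at h
  have hminle : ‖p‖ ^ 2 / κ ^ 2 ≤ min (‖w‖ ^ 2) (‖p‖ ^ 2) := by
    refine le_min ?_ (div_le_self (by positivity) (one_le_pow₀ hκ))
    rw [div_le_iff₀ (by positivity)]
    calc ‖p‖ ^ 2 ≤ (κ * ‖w‖) ^ 2 := by gcongr
      _ = _ := by ring
  have hmS' : 2 * lo * (L * (‖p‖ ^ 2 / κ ^ 2)) ≤ minSharpness L X y p :=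
    le_trans (by gcongr) hmS
  have hpos : 0 < minSharpness L X y p := lt_of_lt_of_le (by positivity) hmS'
  have hS := sharpness_le hA hrisk hup.le hu hVw (sq_norm_wJac_le hV) (by positivity)
  refine ⟨hmin, ?_, ?_⟩
  · rw [one_le_div hpos]
    exact csInf_le ⟨_, hlower⟩ hmem
  · rw [div_le_iff₀ hpos]
    calc sharpness L X y p V ≤ 2 * up * (L * (κ ^ 2 * ‖p‖) ^ 2) := hS
      _ = κ ^ 6 * (up / lo) * (2 * lo * (L * (‖p‖ ^ 2 / κ ^ 2))) := by field_simp
      _ ≤ _ := by gcongr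

/-- Gradient flows from well conditioned parameters of small risk converge to well conditioned
minimizers of the risk. -/
lemma exists_gradientFlow_and_tendsto (hL : 0 < L) (hd : 0 < d) {K r : ℝ} (hK : 1 ≤ K)
    (hM : ∀ k ≤ L, BddUnit K (headProd W₀ k)) (hr0 : 0 < r) (hr : K ^ 2 * r ≤ 1 / 3)
    (hopt : IsOptimalRegressor X y w) (hw : w ≠ 0) (hrank : (empCov X).rank = d)
    {q : ℝ} (hq : 0 ≤ q) (hqr : (2 * K ^ 2) ^ 6 * q < r)
    (hinit : netRisk L X y p W₀ - regRisk X y w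
      ≤ q ^ 2 * covMinEig X ^ 2 * ‖p‖ ^ 2 / covMaxEig X) :
    (∃ W, IsGradientFlow L X y p W₀ W) ∧ ∀ W, IsGradientFlow L X y p W₀ W →
      ∃ V ∈ trapRegion layerCLM W₀ (r / L), Filter.Tendsto W Filter.atTop (nhds V) ∧
        IsMinOn (netRisk L X y p) Set.univ V ∧
        1 ≤ sharpness L X y p V / minSharpness L X y p ∧
        sharpness L X y p V / minSharpness L X y p
          ≤ (2 * K ^ 2) ^ 6 * (covMaxEig X / covMinEig X) := by
  obtain ⟨hlo, hle, hbd⟩ := empCov_bounds hd hrank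
  have hup : 0 < covMaxEig X := hlo.trans_le hle
  have hA := empCov_transpose X
  have hrisk := regRisk_eq_add_excess hopt.1
  have hl := fun v => (hbd v).1
  have hu := fun v => (hbd v).2
  have hL' : (0 : ℝ) < L := by exact_mod_cast hL
  have hwpos : 0 < ‖w‖ := norm_pos_iff.2 hw
  have hκ : 1 ≤ 2 * K ^ 2 := by nlinarith
  -- For `p = 0` the network vanishes and the initial risk condition would force its excess risk, at
  -- least `λ ‖w‖²`, to be nonpositive.
  have hp : p ≠ 0 := by
    rintro rfl
    have h0 : wProd 0 W₀ = 0 := by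
      rw [wProd_eq_act_headProd]
      simp [act]
    have h1 := hl (0 - w)
    rw [netRisk, hrisk, h0, excess] at hinit
    simp only [zero_sub, norm_neg, norm_zero] at h1 hinit
    have : 0 < covMinEig X * ‖w‖ ^ 2 := by positivity
    have hz : q ^ 2 * covMinEig X ^ 2 * (0 : ℝ) ^ 2 / covMaxEig X = 0 := by simp
    rw [hz] at hinit
    linarith
  have hV : ∀ V ∈ trapRegion layerCLM W₀ (r / L), ∀ k ≤ L,
      BddUnit (2 * K ^ 2) (headProd V k) ∧ BddUnit (2 * K ^ 2) (tailProd V k) :=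
    fun V hV k hk => bddUnit_of_mem_trapRegion hM hr0.le hr hV hk
  have hρ : (2 * K ^ 2) ^ 6 * q < L * (r / L) := by
    rwa [mul_div_cancel₀ _ hL'.ne']
  have H := gradientTrap_netRisk hL hA hrisk hlo hup hl hu hp (by linarith) hV hq hρ hinit
  constructor
  · obtain ⟨W, hW0, hWc, hW⟩ := exists_solution_of_contDiff
      (contDiff_gradient_netRisk (L := L) (p := p) hA hrisk).neg W₀ (R := L * (r / L) + 1)
      (by positivity)
    have hsub : trapRegion layerCLM W₀ (r / L) ⊆ Metric.closedBall W₀ (L * (r / L) + 1) := by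
      intro V hVm
      rw [mem_closedBall_iff_norm]
      refine (pow_le_pow_iff_left₀ (norm_nonneg _) (by positivity) two_ne_zero).1 ?_
      have hL1 : (1 : ℝ) ≤ L := by exact_mod_cast hL
      calc ‖V - W₀‖ ^ 2 = ∑ k : Fin L, ‖layerCLM k (V - W₀)‖ ^ 2 := sq_norm_eq_sum_layerCLM _
        _ ≤ ∑ _k : Fin L, (r / L) ^ 2 :=
            Finset.sum_le_sum fun k _ => pow_le_pow_left₀ (norm_nonneg _) (hVm k) 2
        _ = L * (r / L) ^ 2 := by simp
        _ ≤ (L * (r / L)) ^ 2 := by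
            rw [mul_pow]
            gcongr
            exact le_self_pow₀ hL1 two_ne_zero
        _ ≤ _ := by gcongr; linarith
    refine ⟨W, hW0, fun t ht => hW t ht (hsub ?_)⟩
    exact H.mem_trapRegion hW0 hWc (fun t ht hm => hW t ht (hsub hm)) ht
  · intro W hW
    obtain ⟨V, hVm, hlim, hV0⟩ := H.exists_tendsto hW.1 hW.2
    have hVw : wProd p V = w := by
      rw [netRisk, hrisk, add_sub_cancel_left, excess] at hV0
      have h1 := hl (wProd p V - w)
      rw [hV0] at h1
      by_contra hne
      have : 0 < ‖wProd p V - w‖ := norm_pos_iff.2 (sub_ne_zero.2 hne)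
      have : 0 < covMinEig X * ‖wProd p V - w‖ ^ 2 := by positivity
      linarith
    exact ⟨V, hVm, hlim, sharpness_div_minSharpness_bounds hL hA hrisk hlo hup hl hu hp hw hκ hVw
      (hV V hVm)⟩

end Convergence

/-! ### The random residual initialization -/

section ResidualInit

variable {L d : ℕ}

lemma layer_residualParam (s : ℝ) (N θ : Fin L → Matrix (Fin d) (Fin d) ℝ) (k : Fin L) :
    layer (residualParam s N θ) k
      = 1 + (s / Real.sqrt ((L : ℝ) * (d : ℝ))) • N k + (1 / (L : ℝ)) • θ k := rfl

lemma layersT_residualInit (s : ℝ) (N : Fin L → Matrix (Fin d) (Fin d) ℝ) :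
    layersT (residualInit s N) = fun i => 1 + (s / Real.sqrt ((L : ℝ) * (d : ℝ))) •
      (noise (fun a : Fin L × Fin d × Fin d => N a.1 a.2.1 a.2.2) i)ᵀ := by
  funext i
  unfold layersT noise
  split_ifs with h
  · rw [residualInit, layer_residualParam]
    simp only [Pi.zero_apply, smul_zero, add_zero, Matrix.transpose_add, Matrix.transpose_one,
      Matrix.transpose_smul]
    rfl
  · simp

/-- The witness is the rescaled displacement `θ = L (V - W₀)`. -/
lemma exists_residualParam_of_mem_trapRegion {s r : ℝ} (hL : 0 < L)
    {N : Fin L → Matrix (Fin d) (Fin d) ℝ} {V : Param L d}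
    (hV : V ∈ trapRegion layerCLM (residualInit s N) (r / L)) :
    ∃ θ : Fin L → Matrix (Fin d) (Fin d) ℝ, V = residualParam s N θ ∧
      ∀ k, frobNorm (θ k) ≤ r := by
  have hL' : (0 : ℝ) < L := by exact_mod_cast hL
  refine ⟨fun k => layer ((L : ℝ) • (V - residualInit s N)) k, ?_, fun k => ?_⟩
  · have : V = residualInit s N + (V - residualInit s N) := by simp
    ext ⟨k, i, j⟩
    have h2 : layer (residualParam s N fun k => layer ((L : ℝ) • (V - residualInit s N)) k) k i j
        = layer V k i j := by
      rw [layer_residualParam]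
      simp only [Matrix.add_apply, Matrix.smul_apply, layer, Matrix.of_apply, PiLp.smul_apply,
        PiLp.sub_apply, smul_eq_mul]
      have h3 : (residualInit s N : Param L d) (k, i, j)
          = (1 : Matrix (Fin d) (Fin d) ℝ) i j
            + s / Real.sqrt ((L : ℝ) * (d : ℝ)) * N k i j := by
        change layer (residualParam s N 0) k i j = _
        rw [layer_residualParam]
        simp
      rw [h3]
      field_simp
      ring
    exact h2.symm
  · rw [← norm_layerCLM, map_smul, norm_smul, Real.norm_natCast]
    have := hV k
    rw [le_div_iff₀ hL'] at this
    linarith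

open MeasureTheory ProbabilityTheory in
/-- With high probability, the random residual initialization is well conditioned. -/
lemma exists_event_bddUnit_residualInit {Ω : Type*} [MeasurableSpace Ω] {P : Measure Ω}
    [IsProbabilityMeasure P] {N : Ω → Fin L → Matrix (Fin d) (Fin d) ℝ}
    (hN : IsStdGaussianFamily P N) (s : ℝ) (m B : ℕ)
    (hσ : 8192 * (s / Real.sqrt ((L : ℝ) * d)) ^ 2 * m * d ≤ 1)
    (hB : Real.log B ≤ 2 * d) (hB0 : 0 < B) (hBm : L ≤ B * m) :
    ∃ E : Set Ω, MeasurableSet E ∧ 1 - 16 * Real.exp (-1 * (d : ℝ)) ≤ P.real E ∧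
      ∀ ω ∈ E, ∀ k ≤ L, BddUnit (2 ^ B) (headProd (residualInit s (N ω)) k) := by
  obtain ⟨hmeas, hlaw, hind⟩ := hN
  obtain ⟨E, hE, hPE, hgood⟩ := exists_goodEvent
    (X := fun (a : Fin L × Fin d × Fin d) ω => N ω a.1 a.2.1 a.2.2)
    (fun a => hmeas a.1 a.2.1 a.2.2) (fun a => hlaw a.1 a.2.1 a.2.2) hind
    (s / Real.sqrt ((L : ℝ) * d)) m B hσ hB hB0
  refine ⟨E, hE, hPE, fun ω hω k hk => ?_⟩
  rw [headProd, layersT_residualInit]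
  exact hgood ω hω k (hk.trans hBm)

end ResidualInit

end DeepLinear

end

/-! ### Choice of the constants -/

theorem corollary3 (s : ℝ) (hs : 0 ≤ s) :
    ∃ C₁ C₂ C₃ C₄ C₅ C : ℝ,
      0 < C₁ ∧ 0 < C₂ ∧ 0 < C₃ ∧ 0 < C₄ ∧ 0 < C₅ ∧ 0 < C ∧
      ∀ (L d n : ℕ), C₁ ≤ (L : ℝ) → C₂ ≤ (d : ℝ) →
      ∀ (X : Matrix (Fin n) (Fin d) ℝ) (y : EuclideanSpace ℝ (Fin n))
        (p wstar : EuclideanSpace ℝ (Fin d)),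
        DeepLinear.IsOptimalRegressor X y wstar → wstar ≠ 0 →
        (DeepLinear.empCov X).rank = d →
      ∀ (Ω : Type*) [MeasurableSpace Ω] (P : MeasureTheory.Measure Ω)
        [MeasureTheory.IsProbabilityMeasure P]
        (N : Ω → Fin L → Matrix (Fin d) (Fin d) ℝ),
        DeepLinear.IsStdGaussianFamily P N →
        -- an event of high probability
        ∃ E : Set Ω, MeasurableSet E ∧ 1 - 16 * Real.exp (-C₃ * (d : ℝ)) ≤ P.real E ∧
          ∀ ω ∈ E,
            -- on which, if the risk at initialization is small enough,
            DeepLinear.netRisk L X y p (DeepLinear.residualInit s (N ω))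
                - DeepLinear.regRisk X y wstar
              ≤ C₄ * DeepLinear.covMinEig X ^ 2 * ‖p‖ ^ 2 / DeepLinear.covMaxEig X →
            -- the gradient flow exists for all times
            (∃ W : ℝ → DeepLinear.Param L d,
              DeepLinear.IsGradientFlow L X y p (DeepLinear.residualInit s (N ω)) W) ∧
            -- and converges to a global minimizer of the risk with the claimed properties
            ∀ W : ℝ → DeepLinear.Param L d,
              DeepLinear.IsGradientFlow L X y p (DeepLinear.residualInit s (N ω)) W →
              ∃ WRI : DeepLinear.Param L d,
                Filter.Tendsto W Filter.atTop (nhds WRI) ∧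
                IsMinOn (DeepLinear.netRisk L X y p) Set.univ WRI ∧
                (∃ θ : Fin L → Matrix (Fin d) (Fin d) ℝ,
                  WRI = DeepLinear.residualParam s (N ω) θ ∧
                    ∀ k, DeepLinear.frobNorm (θ k) ≤ C₅) ∧
                1 ≤ DeepLinear.sharpness L X y p WRI / DeepLinear.minSharpness L X y p ∧
                DeepLinear.sharpness L X y p WRI / DeepLinear.minSharpness L X y p
                  ≤ C * (DeepLinear.covMaxEig X / DeepLinear.covMinEig X) := by
  -- As `σ² = s² / (L d)`, the block condition `8192 σ² m d ≤ 1` reads `8192 s² m ≤ L`, which `m =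
  -- ⌊L / c⌋` satisfies. The `+ 1` keeps `c` positive when `s = 0`.
  set c : ℝ := 8192 * (s ^ 2 + 1) with hc
  have hc0 : 0 < c := by positivity
  -- For `L ≥ c` the floor `m` is at least `L / (2 c)`, so `2 c` blocks of length `m` cover all
  -- layers, and their number does not depend on `L`.
  set B : ℕ := ⌈2 * c⌉₊ with hB
  have hB0 : 0 < B := Nat.ceil_pos.2 (by positivity)
  set K : ℝ := 2 ^ B with hK
  have hK1 : 1 ≤ K := one_le_pow₀ (by norm_num)
  set r : ℝ := 1 / (3 * K ^ 2) with hr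
  have hr0 : 0 < r := by positivity
  -- The extra `2` gives the strict inequality `(2 * K ^ 2) ^ 6 * q < r`; the constant of the
  -- initial risk condition is `q ^ 2`.
  set q : ℝ := r / (2 * (2 * K ^ 2) ^ 6) with hq
  have hq0 : 0 < q := by positivity
  refine ⟨c, max 1 (Real.log B), 1, q ^ 2, r, (2 * K ^ 2) ^ 6, hc0, by positivity, one_pos,
    by positivity, hr0, by positivity, ?_⟩
  intro L d n hLc hdc X y p wstar hopt hw hrank Ω _ P _ N hN
  have hL' : (0 : ℝ) < L := hc0.trans_le hLc
  have hL : 0 < L := by exact_mod_cast hL'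
  have hd1 : (1 : ℝ) ≤ d := (le_max_left _ _).trans hdc
  have hd' : (0 : ℝ) < d := by linarith
  have hd : 0 < d := by exact_mod_cast hd'
  have hdB : Real.log B ≤ d := (le_max_right _ _).trans hdc
  set m : ℕ := ⌊L / c⌋₊ with hm
  have hmle : (m : ℝ) ≤ L / c := Nat.floor_le (by positivity)
  have hBm : L ≤ B * m := by
    have h1 : (1 : ℝ) ≤ m := by
      have : 1 ≤ m := Nat.le_floor (by rw [Nat.cast_one, one_le_div hc0]; exact hLc)
      exact_mod_cast this
    have h2 : (L : ℝ) / c < m + 1 := Nat.lt_floor_add_one _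
    rw [div_lt_iff₀ hc0] at h2
    have h3 : 2 * c ≤ B := Nat.le_ceil _
    have h4 : (L : ℝ) ≤ B * m := by nlinarith
    exact_mod_cast h4
  have hσ : 8192 * (s / Real.sqrt ((L : ℝ) * d)) ^ 2 * m * d ≤ 1 := by
    rw [div_pow, Real.sq_sqrt (by positivity)]
    have h1 : 8192 * s ^ 2 * m ≤ L := by
      rw [le_div_iff₀ hc0] at hmle
      have : (0 : ℝ) ≤ m := Nat.cast_nonneg m
      nlinarith
    have h2 : 8192 * (s ^ 2 / (L * d)) * m * d = 8192 * s ^ 2 * m / L := by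
      field_simp
    rw [h2, div_le_one hL']
    exact h1
  obtain ⟨E, hE, hPE, hM⟩ := DeepLinear.exists_event_bddUnit_residualInit hN s m B hσ
    (by linarith) hB0 hBm
  refine ⟨E, hE, hPE, fun ω hω hinit => ?_⟩
  have hKr : K ^ 2 * r ≤ 1 / 3 := by
    rw [hr]
    exact le_of_eq (by field_simp)
  have hqr : (2 * K ^ 2) ^ 6 * q < r := by
    have : (2 * K ^ 2) ^ 6 * q = r / 2 := by
      rw [hq]
      field_simp
    linarith
  obtain ⟨hex, hall⟩ := DeepLinear.exists_gradientFlow_and_tendsto hL hd hK1 (hM ω hω) hr0 hKr hopt hw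
    hrank hq0.le hqr hinit
  refine ⟨hex, fun W hW => ?_⟩
  obtain ⟨V, hV, hlim, hmin, hS1, hS2⟩ := hall W hW
  exact ⟨V, hlim, hmin, DeepLinear.exists_residualParam_of_mem_trapRegion hL hV, hS1, hS2⟩
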